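/- Let $d\ge 2$ and let $\mathbb T_d$ be the homogeneous tree in which every vertex has $d+1$ neighbours. Consider the following frog model with removal on $\mathbb T_d$, with parameter $p\in(0,1)$. At time $0$ there is one particle at each vertex; the one at a fixed root is active and all the others are inactive. The particles have independent lifetimes $\mathcal T$ with $\mathbb P(\mathcal T=n)=(1-p)p^n$, $n\ge 0$, and independent simple random walks on $\mathbb T_d$. In each time step all active particles jump simultaneously, each along its own walk, except that a particle which has already made $\mathcal T$ steps is removed. A particle that jumps to a vertex whose particle was inactive before this time step activates that particle and stays active (also if several particles arrive there simultaneously); a particle that jumps to a vertex whose particle had been activated before this time step is removed (removal after $L=1$ unsuccessful jump). Newly activated particles start moving in the next time step. The process survives if at every time there is at least one active particle, and $p_c^{\mathrm r}(d)$ denotes the infimum of the $p\in(0,1)$ for which the probability of survival is positive. Then, for every $d\ge 2$, one has $p_c^{\mathrm r}(d)\in(0,1)$, and $p=p_c^{\mathrm r}(d)$ is the unique solution in $p\in\left(0,\frac{d+1}{d}\right)$ of $$\sum_{k\ge 1}(dq)^k\prod_{i=1}^{k-1}(1-q^i)=1,\qquad q=\frac{p}{d+1}.$$ Moreover $0.8\le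 p_c^{\mathrm r}(2)\le 0.831619$, and for every $d\ge 3$ $$\frac{d+1}{2d-\frac14}\;\le\; p_c^{\mathrm r}(d)\;\le\;\frac{(d+1)(7d-1)\left(1-\sqrt{1-\frac{14}{(7d-1)^2}}\right)}{2}.$$ -/

import Mathlib

open MeasureTheory ProbabilityTheory

noncomputable section

namespace FrogRemoval

/-- The vertices of the homogeneous tree of degree `d + 1`: finite words over `Fin (d + 1)` without
two equal consecutive letters. The root is the empty word. -/
abbrev Vertex (d : ℕ) : Type :=
  {w : List (Fin (d + 1)) // w.IsChain (fun a b => a ≠ b)}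

/-- The root of the tree. -/
def root (d : ℕ) : Vertex d := ⟨[], List.isChain_nil⟩

variable {d : ℕ}

/-- The neighbour of `v` in direction `i`: erase the first letter of `v` if it is `i` (a step towards
the root), otherwise put `i` in front of `v` (a step away from the root). -/
def neighbor (v : Vertex d) (i : Fin (d + 1)) : Vertex d :=
  if h : v.1.head? = some i then ⟨v.1.tail, v.2.tail⟩
  else ⟨i :: v.1, List.isChain_cons.2
    ⟨fun b hb hib => h (by rw [hib]; exact hb), v.2⟩⟩

lemma neighbor_val (v : Vertex d) (i : Fin (d + 1)) :
    (neighbor v i).1 = if v.1.head? = some i then v.1.tail else i :: v.1 := by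
  unfold neighbor; split_ifs <;> rfl

lemma neighbor_neighbor (v : Vertex d) (i : Fin (d + 1)) : neighbor (neighbor v i) i = v := by
  apply Subtype.ext
  obtain ⟨w, hw⟩ := v
  rw [neighbor_val, neighbor_val]
  cases w with
  | nil => simp
  | cons a l =>
    by_cases h : a = i
    · subst h
      have h1 : l.head? ≠ some a := fun h1 => (List.isChain_cons.1 hw).1 a h1 rfl
      simp [h1]
    · simp [h]

lemma neighbor_ne (v : Vertex d) (i : Fin (d + 1)) : neighbor v i ≠ v := by
  intro h
  have h2 := congrArg (fun u => u.1.length) h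
  simp only [neighbor_val] at h2
  obtain ⟨w, hw⟩ := v
  cases w with
  | nil => simp at h2
  | cons a l => by_cases h : a = i <;> simp [h] at h2

/-- The homogeneous tree `𝕋_d` of degree `d + 1`. -/
def tree (d : ℕ) : SimpleGraph (Vertex d) where
  Adj u v := ∃ i, neighbor u i = v
  symm := ⟨by rintro u v ⟨i, rfl⟩; exact ⟨i, neighbor_neighbor u i⟩⟩
  loopless := ⟨by rintro v ⟨i, hi⟩; exact neighbor_ne v i hi⟩

/-- Distinct directions lead to distinct neighbours, so every vertex has exactly `d + 1` neighbours,
and a uniform direction gives a uniform neighbour. -/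
lemma neighbor_injective (v : Vertex d) : Function.Injective (neighbor v) := by
  intro i j h
  have h2 := congrArg Subtype.val h
  simp only [neighbor_val] at h2
  obtain ⟨w, hw⟩ := v
  cases w with
  | nil => simpa using h2
  | cons a l =>
    by_cases hi : a = i <;> by_cases hj : a = j
    · exact hi.symm.trans hj
    · subst hi
      have := congrArg List.length h2
      simp [hj] at this; omega
    · subst hj
      have := congrArg List.length h2
      simp [hi] at this; omega
    · simpa [hi, hj] using h2

lemma neighborSet_eq (v : Vertex d) : (tree d).neighborSet v = Set.range (neighbor v) := rfl

lemma ncard_neighborSet (v : Vertex d) : ((tree d).neighborSet v).ncard = d + 1 := by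
  rw [neighborSet_eq, ← Set.image_univ, Set.ncard_image_of_injective _ (neighbor_injective v)]
  simp [Set.ncard_univ]

lemma val_eq_tail_of_adj {u v : Vertex d} (h : (tree d).Adj u v)
    (hl : v.1.length ≤ u.1.length) : v.1 = u.1.tail := by
  obtain ⟨i, rfl⟩ := h
  rw [neighbor_val] at hl ⊢
  split_ifs at hl ⊢ with h
  · rfl
  · simp at hl

lemma tree_isTree (d : ℕ) : (tree d).IsTree := by
  have : Nonempty (Vertex d) := ⟨root d⟩
  refine SimpleGraph.IsTree.mk ⟨?_⟩ ?_
  · have key : ∀ v : Vertex d, (tree d).Reachable v (root d) := by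
      rintro ⟨w, hw⟩
      induction w with
      | nil => exact SimpleGraph.Reachable.refl _
      | cons a l ih =>
        refine SimpleGraph.Reachable.trans (SimpleGraph.Adj.reachable ?_) (ih hw.tail)
        exact ⟨a, Subtype.ext (by simp [neighbor_val])⟩
    exact fun u v => (key u).trans (key v).symm
  · intro v c hc
    obtain ⟨u, hu, hmax⟩ := c.support.toFinset.exists_max_image (fun x => x.1.length)
      ⟨v, by simp⟩
    have hu' : u ∈ c.support := by simpa using hu
    have hc' := hc.rotate hu'
    have hmem : ∀ x ∈ (c.rotate u hu').support, x.1.length ≤ u.1.length := by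
      intro x hx
      refine hmax x ?_
      simpa using hx
    refine hc'.snd_ne_penultimate (Subtype.ext ?_)
    rw [val_eq_tail_of_adj ((c.rotate u hu').adj_snd hc'.not_nil)
        (hmem _ (SimpleGraph.Walk.getVert_mem_support _ _)),
      val_eq_tail_of_adj ((c.rotate u hu').adj_penultimate hc'.not_nil).symm
        (hmem _ (SimpleGraph.Walk.getVert_mem_support _ _))]

/-- The randomness of the model: each particle (named after its initial vertex) has a lifetime and an
infinite sequence of directions. -/
abbrev Outcome (d : ℕ) : Type := Vertex d → ℕ × (ℕ → Fin (d + 1))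

/-- The law of the randomness: all lifetimes and all directions are independent, the lifetimes are
geometric with parameter `1 - p`, i.e. `ℙ(lifetime = n) = (1 - p) * p ^ n` for `n ≥ 0`, and the
directions are uniform. -/
def law (d : ℕ) (p : unitInterval) : Measure (Outcome d) :=
  Measure.infinitePi fun _ : Vertex d =>
    (geometricMeasure (unitInterval.symm p)).prod
      (Measure.infinitePi fun _ : ℕ => uniformOn (Set.univ : Set (Fin (d + 1))))

/-- The number of steps that the particle `x` can make. -/
def lifetime (ω : Outcome d) (x : Vertex d) : ℕ := (ω x).1

/-- The simple random walk of the particle `x`: its position after `n` steps. -/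
def walk (ω : Outcome d) (x : Vertex d) : ℕ → Vertex d
  | 0 => x
  | n + 1 => neighbor (walk ω x n) ((ω x).2 n)

/-- A state of the system. -/
structure State (d : ℕ) where
  /-- the vertices whose particle has already been activated -/
  visited : Set (Vertex d)
  /-- the pairs `(x, n)` such that particle `x` is active and has made `n` steps so far -/
  active : Set (Vertex d × ℕ)

/-- At time `0` only the particle at the root is active. -/
def initialState (d : ℕ) : State d := ⟨{root d}, {(root d, 0)}⟩

/-- The vertices to which active particles jump in the next time step: a particle that has not yet
reached the end of its lifetime jumps, the others are removed. -/
def jumpTargets (ω : Outcome d) (s : State d) : Set (Vertex d) :=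
  {y | ∃ x n, (x, n) ∈ s.active ∧ n < lifetime ω x ∧ walk ω x (n + 1) = y}

/-- One time step. All surviving active particles jump simultaneously. A particle that jumps to a
vertex whose own particle was inactive before the jump activates it and stays in the system; a particle
that jumps to a vertex whose own particle had been activated before is removed. -/
def step (ω : Outcome d) (s : State d) : State d where
  visited := s.visited ∪ jumpTargets ω s
  active :=
    {a | ∃ x n, (x, n) ∈ s.active ∧ n < lifetime ω x ∧ walk ω x (n + 1) ∉ s.visited ∧
      a = (x, n + 1)} ∪
    {a | ∃ y ∈ jumpTargets ω s, y ∉ s.visited ∧ a = (y, 0)}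

/-- The state of the system at time `t`. -/
def stateAt (ω : Outcome d) : ℕ → State d
  | 0 => initialState d
  | t + 1 => step ω (stateAt ω t)

/-- The event of survival: at every time there is at least one active particle. -/
def survival (d : ℕ) : Set (Outcome d) := {ω | ∀ t, (stateAt ω t).active.Nonempty}

/-- The probability of survival. -/
def survivalProb (d : ℕ) (p : unitInterval) : ℝ := (law d p).real (survival d)

/-- The critical parameter `p_c^r(d)`. -/
def criticalParameter (d : ℕ) : ℝ :=
  sInf {x : ℝ | ∃ p : unitInterval, (p : ℝ) = x ∧ 0 < x ∧ x < 1 ∧ 0 < survivalProb d p}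

/-- The equation `∑_{k ≥ 1} c (d q)^k ∏_{i=1}^{k-1} (1 - c q^i) = 1` (the series converges, with
sum `1`); the index is shifted, `k = j + 1`. -/
def LocalizationEq (d : ℕ) (c q : ℝ) : Prop :=
  HasSum (fun j : ℕ => c * ((d : ℝ) * q) ^ (j + 1) * ∏ i ∈ Finset.Icc 1 j, (1 - c * q ^ i)) 1

end FrogRemoval

end

/-! Every ancestor of an activated vertex has been activated, so a jump towards the root is always
fatal. Hence the particles active at time `t` sit at level `t` and have only moved outwards, and a
vertex `v` can hold active particles only at time `|v|`. Put `q = p / (d + 1)`. If `v` holds `k`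
particles, each of them independently jumps to a given child with probability `q`; when `B > 0` of
them arrive there, the child holds `B + 1` particles, and otherwise none. The process is thus a
branching process whose types are occupation numbers, and only the mean operator of this process
matters.

The mean operator acts simply on `hitFun u k = 1 - (1 - u) ^ k`: by the binomial generating
function, the expectation of `hitFun u` at a child is `u * hitFun q k + (1 - u) * hitFun (q * u) k`
(`integral_hitFun_childOccupants`). So the functions with `u = q, q², q³, …` form an invariant chain
in which every index either returns to the first or moves on by one. The total weight of the
excursions from the first index, with a factor `d` per step, is the series `locSum d q` of the
equation.

If `locSum d q < 1`, the renewal equation of the chain shows that the expected number of occupied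
vertices at level `n` tends to zero (`tendsto_measureReal_levelVisited`). If `locSum d q > 1`, a
finite truncation of the eigenfunction is bounded and is expanded by a factor `1 + ε`; with this
function `f`, the expectation of the product of `1 - θ f` over a level does not increase with the
level, which bounds the probability of extinction away from one
(`exists_le_measureReal_levelVisited`).

For `d ≥ 2`, `locSum d` is strictly increasing and continuous where `d q < 1`, so its unique
solution of `locSum d q = 1` is the critical value (`criticalParameter_eq`). The numerical bounds
follow by comparing the tail of the series with geometric series. -/

namespace FrogRemoval

/-! ### Monotonicity and continuity of the series -/

/-- The terms of the series in `LocalizationEq d 1 q`. -/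
noncomputable def locTerm (d : ℕ) (q : ℝ) (j : ℕ) : ℝ :=
  ((d : ℝ) * q) ^ (j + 1) * ∏ i ∈ Finset.Icc 1 j, (1 - q ^ i)

lemma localizationEq_one_iff {d : ℕ} {q : ℝ} :
    LocalizationEq d 1 q ↔ HasSum (locTerm d q) 1 := by
  unfold LocalizationEq locTerm
  simp

lemma locTerm_zero (d : ℕ) (q : ℝ) : locTerm d q 0 = d * q := by simp [locTerm]

lemma locTerm_succ (d : ℕ) (q : ℝ) (j : ℕ) :
    locTerm d q (j + 1) = locTerm d q j * (d * (q * (1 - q ^ (j + 1)))) := by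
  simp only [locTerm]
  rw [Finset.prod_Icc_succ_top (by omega)]
  ring

lemma prod_one_sub_pow_nonneg {q : ℝ} (h0 : 0 ≤ q) (h1 : q ≤ 1) (j : ℕ) :
    0 ≤ ∏ i ∈ Finset.Icc 1 j, (1 - q ^ i) :=
  Finset.prod_nonneg fun i _ => by linarith [pow_le_one₀ h0 h1 (n := i)]

lemma prod_one_sub_pow_le_one {q : ℝ} (h0 : 0 ≤ q) (h1 : q ≤ 1) (j : ℕ) :
    ∏ i ∈ Finset.Icc 1 j, (1 - q ^ i) ≤ 1 :=
  Finset.prod_le_one (fun i _ => by linarith [pow_le_one₀ h0 h1 (n := i)])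
    (fun i _ => by linarith [pow_nonneg h0 i])

lemma locTerm_nonneg (d : ℕ) {q : ℝ} (h0 : 0 ≤ q) (h1 : q ≤ 1) (j : ℕ) : 0 ≤ locTerm d q j :=
  mul_nonneg (by positivity) (prod_one_sub_pow_nonneg h0 h1 j)

lemma locTerm_le (d : ℕ) {q : ℝ} (h0 : 0 ≤ q) (h1 : q ≤ 1) (j : ℕ) :
    locTerm d q j ≤ (d * q) ^ (j + 1) :=
  mul_le_of_le_one_right (by positivity) (prod_one_sub_pow_le_one h0 h1 j)

lemma le_one_of_natCast_mul_lt_one {d : ℕ} (hd : 1 ≤ d) {q : ℝ}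
    (h1 : (d : ℝ) * q < 1) : q ≤ 1 := by
  have : (1 : ℝ) ≤ d := by exact_mod_cast hd
  nlinarith

lemma summable_locTerm {d : ℕ} (hd : 1 ≤ d) {q : ℝ} (h0 : 0 ≤ q) (h1 : (d : ℝ) * q < 1) :
    Summable (locTerm d q) := by
  have hq := le_one_of_natCast_mul_lt_one hd h1
  refine Summable.of_nonneg_of_le (locTerm_nonneg d h0 hq) (locTerm_le d h0 hq) ?_
  exact (summable_nat_add_iff 1).2 (summable_geometric_of_lt_one (by positivity) h1)

/-- The left-hand side of the equation. -/
noncomputable def locSum (d : ℕ) (q : ℝ) : ℝ := ∑' j, locTerm d q j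

/-- On `[0, 1/2]` the power `x ^ (n + 2)` has slope at most `(n + 2) / 2 ^ (n + 1) ≤ 1`, so
subtracting it from `x` leaves a nondecreasing function. This is where `d ≥ 2` enters: it forces `q
≤ 1/2`. -/
lemma mul_one_sub_pow_mono {a b : ℝ} (ha : 0 ≤ a) (hab : a ≤ b) (hb : b ≤ 1 / 2) (n : ℕ) :
    a * (1 - a ^ (n + 1)) ≤ b * (1 - b ^ (n + 1)) := by
  have hb0 : 0 ≤ b := ha.trans hab
  have key : ∀ m : ℕ, b ^ (m + 2) - a ^ (m + 2) ≤ (b - a) * ((m + 2) * (1 / 2) ^ (m + 1)) := by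
    intro m
    induction m with
    | zero => norm_num; nlinarith
    | succ m ih =>
      have h1 : b ^ (m + 1 + 2) - a ^ (m + 1 + 2)
        = b * (b ^ (m + 2) - a ^ (m + 2)) + a ^ (m + 2) * (b - a) := by ring
      have h2 : a ^ (m + 2) ≤ (1 / 2 : ℝ) ^ (m + 2) := pow_le_pow_left₀ ha (hab.trans hb) _
      have h3 : 0 ≤ b ^ (m + 2) - a ^ (m + 2) := sub_nonneg.2 (pow_le_pow_left₀ ha hab _)
      have h4 : b * (b ^ (m + 2) - a ^ (m + 2)) ≤ 1 / 2 * (b ^ (m + 2) - a ^ (m + 2)) := by gcongr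
      have h5 : a ^ (m + 2) * (b - a) ≤ (1 / 2 : ℝ) ^ (m + 2) * (b - a) :=
        mul_le_mul_of_nonneg_right h2 (sub_nonneg.2 hab)
      rw [h1]
      push_cast
      have e : (b - a) * (((m : ℝ) + 1 + 2) * (1 / 2) ^ (m + 1 + 1))
        = 1 / 2 * ((b - a) * ((m + 2) * (1 / 2) ^ (m + 1))) + (1 / 2 : ℝ) ^ (m + 2) * (b - a) := by
        ring
      rw [e]
      linarith
  have h2 : ((n : ℝ) + 2) * (1 / 2) ^ (n + 1) ≤ 1 := by
    have : n + 2 ≤ 2 ^ (n + 1) := Nat.lt_two_pow_self (n := n + 1)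
    have h : ((n : ℝ) + 2) ≤ 2 ^ (n + 1) := by exact_mod_cast this
    rw [one_div, inv_pow, ← div_eq_mul_inv]
    exact div_le_one_of_le₀ h (by positivity)
  have h3 := key n
  have h4 : (b - a) * ((n + 2) * (1 / 2) ^ (n + 1)) ≤ (b - a) * 1 :=
    mul_le_mul_of_nonneg_left h2 (sub_nonneg.2 hab)
  have e1 : a * (1 - a ^ (n + 1)) = a - a ^ (n + 2) := by ring
  have e2 : b * (1 - b ^ (n + 1)) = b - b ^ (n + 2) := by ring
  rw [e1, e2]
  linarith

lemma locTerm_mono (d : ℕ) {a b : ℝ} (ha : 0 ≤ a) (hab : a ≤ b) (hb : b ≤ 1 / 2) (j : ℕ) :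
    locTerm d a j ≤ locTerm d b j := by
  induction j with
  | zero => rw [locTerm_zero, locTerm_zero]; gcongr
  | succ j ih =>
    rw [locTerm_succ, locTerm_succ]
    have h0 : 0 ≤ a * (1 - a ^ (j + 1)) :=
      mul_nonneg ha (by linarith [pow_le_one₀ ha (by linarith : a ≤ 1) (n := j + 1)])
    have := mul_one_sub_pow_mono ha hab hb j
    have h1 := locTerm_nonneg d ha (by linarith) j
    gcongr
    exact h1.trans ih

lemma le_half_of_natCast_mul_lt_one {d : ℕ} (hd : 2 ≤ d) {q : ℝ}
    (h1 : (d : ℝ) * q < 1) : q ≤ 1 / 2 := by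
  have : (2 : ℝ) ≤ d := by exact_mod_cast hd
  nlinarith

lemma locSum_strictMono {d : ℕ} (hd : 2 ≤ d) {a b : ℝ} (ha : 0 ≤ a) (hab : a < b)
    (hb : (d : ℝ) * b < 1) : locSum d a < locSum d b := by
  have hb2 := le_half_of_natCast_mul_lt_one hd hb
  have hd0 : (0 : ℝ) < d := by positivity
  refine Summable.tsum_lt_tsum (i := 0) (fun j => locTerm_mono d ha hab.le hb2 j) ?_
    (summable_locTerm (by omega) ha ?_) (summable_locTerm (by omega) (ha.trans hab.le) hb)
  · rw [locTerm_zero, locTerm_zero]; gcongr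
  · nlinarith

lemma continuousOn_locSum {d : ℕ} (hd : 2 ≤ d) {b : ℝ} (hb : (d : ℝ) * b < 1) :
    ContinuousOn (locSum d) (Set.Icc 0 b) := by
  rcases lt_or_ge b 0 with h | h0
  · simp [Set.Icc_eq_empty_of_lt h]
  -- By monotonicity the terms at the right endpoint `b` dominate, as in the Weierstrass test.
  refine continuousOn_tsum (u := locTerm d b) (fun j => ?_) (summable_locTerm (by omega) h0 hb) ?_
  · unfold locTerm; fun_prop
  · intro j x hx
    have hb2 := le_half_of_natCast_mul_lt_one hd hb
    rw [Real.norm_of_nonneg (locTerm_nonneg d hx.1 (by linarith [hx.2]) j)]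
    exact locTerm_mono d hx.1 hx.2 hb2 j

/-! ### Explicit bounds for the series and for its root -/

lemma locSum_eq_two_add {d : ℕ} (hd : 1 ≤ d) {q : ℝ} (h0 : 0 ≤ q) (h1 : (d : ℝ) * q < 1) :
    locSum d q = d * q + (d * q) ^ 2 * (1 - q) + ∑' j, locTerm d q (j + 2) := by
  unfold locSum
  rw [← (summable_locTerm hd h0 h1).sum_add_tsum_nat_add 2]
  simp [Finset.sum_range_succ, locTerm]

/-- From the third term on, the product is at most its first two factors, and the rest is geometric.
-/
lemma locSum_le {d : ℕ} (hd : 1 ≤ d) {q : ℝ} (h0 : 0 ≤ q) (h1 : (d : ℝ) * q < 1) :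
    locSum d q ≤ d * q + (d * q) ^ 2 * (1 - q)
      + (1 - q) * (1 - q ^ 2) * ((d * q) ^ 3 / (1 - d * q)) := by
  rw [locSum_eq_two_add hd h0 h1]
  have hq := le_one_of_natCast_mul_lt_one hd h1
  gcongr
  have hg : HasSum (fun j : ℕ => (1 - q) * (1 - q ^ 2) * (d * q) ^ 3 * (d * q) ^ j)
      ((1 - q) * (1 - q ^ 2) * (d * q) ^ 3 * (1 - d * q)⁻¹) :=
    (hasSum_geometric_of_lt_one (by positivity) h1).mul_left _
  have e : (1 - q) * (1 - q ^ 2) * ((d * q) ^ 3 / (1 - d * q))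
      = (1 - q) * (1 - q ^ 2) * (d * q) ^ 3 * (1 - d * q)⁻¹ := by ring
  rw [e, ← hg.tsum_eq]
  refine Summable.tsum_le_tsum (fun j => ?_)
    ((summable_nat_add_iff 2).2 (summable_locTerm hd h0 h1)) hg.summable
  induction j with
  | zero =>
    have : Finset.Icc 1 2 = {1, 2} := rfl
    refine le_of_eq ?_
    simp [locTerm, this]; ring
  | succ j ih =>
    have hp : 0 ≤ locTerm d q (j + 2) := locTerm_nonneg d h0 hq _
    have e2 : locTerm d q (j + 1 + 2) = locTerm d q (j + 2) * (d * q) * (1 - q ^ (j + 2 + 1)) := by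
      rw [show j + 1 + 2 = (j + 2) + 1 by ring, locTerm_succ]; ring
    rw [e2]
    calc locTerm d q (j + 2) * (d * q) * (1 - q ^ (j + 2 + 1))
        ≤ locTerm d q (j + 2) * (d * q) :=
          mul_le_of_le_one_right (by positivity) (by linarith [pow_nonneg h0 (j + 2 + 1)])
      _ ≤ (1 - q) * (1 - q ^ 2) * (d * q) ^ 3 * (d * q) ^ j * (d * q) := by gcongr
      _ = _ := by ring

/-- These are the leading terms of Euler's pentagonal expansion. The extra `q ^ (j + 3)` makes the
induction close: the two sides of the step differ by `q ^ (j + 3) * (q ^ 2 - q ^ (j + 3))`. -/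
lemma prod_one_sub_pow_ge {q : ℝ} (h0 : 0 ≤ q) (h1 : q ≤ 1 / 2) (j : ℕ) :
    1 - q - q ^ 2 + q ^ (j + 3) ≤ ∏ i ∈ Finset.Icc 1 (j + 2), (1 - q ^ i) := by
  induction j with
  | zero =>
    have : Finset.Icc 1 2 = {1, 2} := rfl
    refine le_of_eq ?_
    simp [this]; ring
  | succ j ih =>
    rw [show j + 1 + 2 = (j + 2) + 1 by ring, Finset.prod_Icc_succ_top (by omega)]
    have hp : q ^ (j + 2 + 1) ≤ 1 := pow_le_one₀ h0 (by linarith)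
    have hpos : 0 ≤ q ^ (j + 3) := by positivity
    refine le_trans ?_ (mul_le_mul_of_nonneg_right ih (by linarith))
    have hj : q ^ j ≤ 1 := pow_le_one₀ h0 (by linarith)
    have e : (1 - q - q ^ 2 + q ^ (j + 3)) * (1 - q ^ (j + 2 + 1)) -
      (1 - q - q ^ 2 + q ^ (j + 1 + 3)) = q ^ (j + 3) * (q ^ 2 - q ^ (j + 3)) := by ring
    have h3 : q ^ (j + 3) ≤ q ^ 2 := pow_le_pow_of_le_one h0 (by linarith) (by omega)
    nlinarith [mul_nonneg hpos (sub_nonneg.2 h3)]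

lemma le_locSum {d : ℕ} (hd : 2 ≤ d) {q : ℝ} (h0 : 0 ≤ q) (h1 : (d : ℝ) * q < 1) :
    d * q + (d * q) ^ 2 * (1 - q) + (1 - q - q ^ 2) * ((d * q) ^ 3 / (1 - d * q))
      ≤ locSum d q := by
  rw [locSum_eq_two_add (by omega) h0 h1]
  have hq := le_half_of_natCast_mul_lt_one hd h1
  gcongr
  have hg : HasSum (fun j : ℕ => (1 - q - q ^ 2) * (d * q) ^ 3 * (d * q) ^ j)
      ((1 - q - q ^ 2) * (d * q) ^ 3 * (1 - d * q)⁻¹) :=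
    (hasSum_geometric_of_lt_one (by positivity) h1).mul_left _
  have e : (1 - q - q ^ 2) * ((d * q) ^ 3 / (1 - d * q))
      = (1 - q - q ^ 2) * (d * q) ^ 3 * (1 - d * q)⁻¹ := by ring
  rw [e, ← hg.tsum_eq]
  refine Summable.tsum_le_tsum (fun j => ?_) hg.summable
    ((summable_nat_add_iff 2).2 (summable_locTerm (by omega) h0 h1))
  have := prod_one_sub_pow_ge h0 hq j
  have h3 : 0 ≤ q ^ (j + 3) := by positivity
  calc (1 - q - q ^ 2) * (d * q) ^ 3 * (d * q) ^ j
      = (d * q) ^ (j + 2 + 1) * (1 - q - q ^ 2) := by ring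
    _ ≤ _ := by unfold locTerm; gcongr; linarith

lemma locSum_two_lower : locSum 2 (4 / 15) ≤ 1 := by
  refine (locSum_le (d := 2) (by norm_num) (by norm_num) (by norm_num)).trans ?_
  norm_num

lemma locSum_two_upper : 1 ≤ locSum 2 (0.831619 / 3) := by
  refine le_trans ?_ (le_locSum (d := 2) (by norm_num) (by norm_num) (by norm_num))
  norm_num

lemma locSum_lower {d : ℕ} (hd : 3 ≤ d) : locSum d (1 / (2 * d - 1 / 4)) ≤ 1 := by
  have hd' : (3 : ℝ) ≤ d := by exact_mod_cast hd
  have hpos : (0 : ℝ) < 2 * d - 1 / 4 := by linarith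
  set q : ℝ := 1 / (2 * d - 1 / 4) with hq
  have hq0 : 0 < q := by positivity
  have hq1 : q ≤ 4 / 23 := by
    rw [hq, div_le_div_iff₀ hpos (by norm_num)]; linarith
  -- The coefficient `1/8` cancels the term linear in `q`, so that the remaining gap is `q ^ 2`
  -- times a positive factor.
  have hx : (d : ℝ) * q = 1 / 2 + q / 8 := by
    have : (2 * d - 1 / 4) * q = 1 := mul_one_div_cancel hpos.ne'
    linarith
  refine (locSum_le (by omega) hq0.le (by rw [hx]; linarith)).trans ?_
  rw [hx]
  have h1 : (0 : ℝ) < 1 - (1 / 2 + q / 8) := by linarith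
  rw [← le_sub_iff_add_le', mul_div_assoc', div_le_iff₀ h1, ← sub_nonneg]
  have e : (1 - ((1 / 2 + q / 8) + (1 / 2 + q / 8) ^ 2 * (1 - q))) * (1 - (1 / 2 + q / 8))
      - (1 - q) * (1 - q ^ 2) * (1 / 2 + q / 8) ^ 3
      = q ^ 2 * (1 / 4 - 1 / 64 * q - 9 / 128 * q ^ 2 - 11 / 512 * q ^ 3 - 1 / 512 * q ^ 4) := by
    ring
  rw [e]
  have p2 : q ^ 2 ≤ 1 := pow_le_one₀ hq0.le (by linarith)
  have p3 : q ^ 3 ≤ 1 := pow_le_one₀ hq0.le (by linarith)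
  have p4 : q ^ 4 ≤ 1 := pow_le_one₀ hq0.le (by linarith)
  exact mul_nonneg (by positivity) (by linarith)

/-- The smaller root of `2 q² - 2 (7 d - 1) q + 7 = 0`. -/
noncomputable def upperRoot (d : ℕ) : ℝ :=
  (7 * (d : ℝ) - 1) * (1 - Real.sqrt (1 - 14 / (7 * (d : ℝ) - 1) ^ 2)) / 2

lemma upperRoot_spec {d : ℕ} (hd : 3 ≤ d) :
    0 < upperRoot d ∧ upperRoot d ≤ 3 / 16 ∧
      (d : ℝ) * upperRoot d = 1 / 2 + upperRoot d / 7 + upperRoot d ^ 2 / 7 := by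
  have hd' : (3 : ℝ) ≤ d := by exact_mod_cast hd
  set m : ℝ := 7 * (d : ℝ) - 1 with hm
  have hm20 : 20 ≤ m := by linarith
  have hm0 : 0 < m := by linarith
  have h14 : 14 / m ^ 2 ≤ 1 := by rw [div_le_one (by positivity)]; nlinarith
  set s : ℝ := Real.sqrt (1 - 14 / m ^ 2) with hs
  have hss : s ^ 2 = 1 - 14 / m ^ 2 := Real.sq_sqrt (by linarith)
  have hs1 : s < 1 := by
    rw [hs, Real.sqrt_lt' one_pos]
    have : 0 < 14 / m ^ 2 := by positivity
    linarith
  -- This is equivalent to the bound `3/16` for the root; it needs `48 * m ≥ 905`, and `m ≥ 20`.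
  have hs2 : 1 - 3 / (8 * m) ≤ s := by
    apply Real.le_sqrt_of_sq_le
    have e : 1 - 14 / m ^ 2 - (1 - 3 / (8 * m)) ^ 2 = (48 * m - 905) / (64 * m ^ 2) := by
      field_simp; ring
    have : 0 ≤ (48 * m - 905) / (64 * m ^ 2) := div_nonneg (by linarith) (by positivity)
    linarith
  have hu : upperRoot d = m * (1 - s) / 2 := rfl
  have hms : m ^ 2 * s ^ 2 = m ^ 2 - 14 := by rw [hss]; field_simp
  refine ⟨?_, ?_, ?_⟩
  · rw [hu]
    have : 0 < 1 - s := by linarith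
    positivity
  · rw [hu]
    have : m * (1 - s) ≤ m * (3 / (8 * m)) := by gcongr; linarith
    have e : m * (3 / (8 * m)) = 3 / 8 := by field_simp
    linarith
  · have hdm : (d : ℝ) = (m + 1) / 7 := by rw [hm]; ring
    rw [hu, hdm]
    linear_combination (1 / 28 : ℝ) * (-hms)

lemma locSum_upper {d : ℕ} (hd : 3 ≤ d) : 1 ≤ locSum d (upperRoot d) := by
  obtain ⟨hq0, hq1, hx⟩ := upperRoot_spec hd
  set q := upperRoot d
  have hq2 : q ^ 2 ≤ 9 / 256 := by nlinarith
  refine le_trans ?_ (le_locSum (by omega) hq0.le (by rw [hx]; linarith))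
  rw [hx]
  have h1 : (0 : ℝ) < 1 - (1 / 2 + q / 7 + q ^ 2 / 7) := by linarith
  rw [← sub_le_iff_le_add', mul_div_assoc', le_div_iff₀ h1, ← sub_nonneg]
  -- Since `1/7 > 1/8`, a positive linear term `q / 28` survives and dominates the negative terms.
  have e : (1 - q - q ^ 2) * (1 / 2 + q / 7 + q ^ 2 / 7) ^ 3
      - (1 - (1 / 2 + q / 7 + q ^ 2 / 7 + (1 / 2 + q / 7 + q ^ 2 / 7) ^ 2 * (1 - q)))
        * (1 - (1 / 2 + q / 7 + q ^ 2 / 7))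
      = q * (1 / 28 + 1 / 56 * q - 53 / 196 * q ^ 2 - 5 / 28 * q ^ 3 - 29 / 343 * q ^ 4
        - 27 / 686 * q ^ 5 - 3 / 343 * q ^ 6 - 1 / 343 * q ^ 7) := by
    ring
  rw [e]
  have hp : ∀ n, q ^ (n + 2) ≤ 9 / 256 * q ^ n := fun n => by
    rw [pow_add, mul_comm]; gcongr
  have p3 := hp 1
  have p4 := hp 2
  have p5 := hp 3
  have p6 := hp 4
  have p7 := hp 5
  exact mul_nonneg hq0.le (by norm_num at *; linarith)

/-- For `d ≥ 2` the equation has a solution between any lower and upper bound. -/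
lemma exists_locSum_eq_one {d : ℕ} (hd : 2 ≤ d) {a b : ℝ} (ha : 0 ≤ a) (hab : a ≤ b)
    (hb : (d : ℝ) * b < 1) (h1 : locSum d a ≤ 1) (h2 : 1 ≤ locSum d b) :
    ∃ q ∈ Set.Icc a b, locSum d q = 1 := by
  have := intermediate_value_Icc hab
    ((continuousOn_locSum hd hb).mono (Set.Icc_subset_Icc_left ha))
  obtain ⟨q, hq, h⟩ := this ⟨h1, h2⟩
  exact ⟨q, hq, h⟩

lemma exists_root_two :
    ∃ q ∈ Set.Icc (4 / 15 : ℝ) (0.831619 / 3), locSum 2 q = 1 :=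
  exists_locSum_eq_one le_rfl (by norm_num) (by norm_num) (by norm_num) locSum_two_lower
    locSum_two_upper

lemma exists_root_of_three_le {d : ℕ} (hd : 3 ≤ d) :
    ∃ q ∈ Set.Icc (1 / (2 * (d : ℝ) - 1 / 4)) (upperRoot d), locSum d q = 1 := by
  obtain ⟨hq0, hq1, hx⟩ := upperRoot_spec hd
  have hd' : (3 : ℝ) ≤ d := by exact_mod_cast hd
  have hpos : (0 : ℝ) < 2 * d - 1 / 4 := by linarith
  refine exists_locSum_eq_one (by omega) (by positivity) ?_ ?_ (locSum_lower hd) (locSum_upper hd)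
  · rw [div_le_iff₀ hpos]
    nlinarith
  · rw [hx]
    nlinarith

lemma localizationEq_iff_locSum {d : ℕ} (hd : 1 ≤ d) {q : ℝ} (h0 : 0 ≤ q)
    (h1 : (d : ℝ) * q < 1) : LocalizationEq d 1 q ↔ locSum d q = 1 := by
  rw [localizationEq_one_iff]
  exact ⟨fun h => h.tsum_eq, fun h => h ▸ (summable_locTerm hd h0 h1).hasSum⟩

/-! ### The renewal equation of the chain of hitting functions -/

/-- The coefficients `d ^ m * ∏_{i=1}^m (1 - q ^ i)` of the eigenfunction of the mean operator. -/
noncomputable def eigenCoeff (d : ℕ) (q : ℝ) (m : ℕ) : ℝ :=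
  (d : ℝ) ^ m * ∏ i ∈ Finset.Icc 1 m, (1 - q ^ i)

lemma eigenCoeff_zero (d : ℕ) (q : ℝ) : eigenCoeff d q 0 = 1 := by simp [eigenCoeff]

lemma eigenCoeff_succ (d : ℕ) (q : ℝ) (m : ℕ) :
    eigenCoeff d q (m + 1) = eigenCoeff d q m * (d * (1 - q ^ (m + 1))) := by
  simp only [eigenCoeff]
  rw [Finset.prod_Icc_succ_top (by omega)]
  ring

lemma locTerm_eq_eigenCoeff (d : ℕ) (q : ℝ) (m : ℕ) :
    locTerm d q m = eigenCoeff d q m * (d * q ^ (m + 1)) := by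
  simp only [eigenCoeff, locTerm]; ring

lemma eigenCoeff_nonneg (d : ℕ) {q : ℝ} (h0 : 0 ≤ q) (h1 : q ≤ 1) (m : ℕ) :
    0 ≤ eigenCoeff d q m :=
  mul_nonneg (by positivity) (prod_one_sub_pow_nonneg h0 h1 m)

section renewal

variable {d : ℕ} {q : ℝ} {y : ℕ → ℕ → ℝ}

/-- Unrolling the recursion along the second index splits off one return to index `0` at each step,
with weight `locTerm d q j`; for `m = n` this is a renewal equation. -/
lemma renewal_expand
    (hy : ∀ n i, y (n + 1) i = d * q ^ (i + 1) * y n 0 + d * (1 - q ^ (i + 1)) * y n (i + 1))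
    (n m : ℕ) (hm : m ≤ n) :
    y n 0 = ∑ j ∈ Finset.range m, locTerm d q j * y (n - 1 - j) 0
      + eigenCoeff d q m * y (n - m) m := by
  induction m with
  | zero => simp [eigenCoeff_zero]
  | succ m ih =>
    rw [ih (by omega), Finset.sum_range_succ, show n - m = (n - (m + 1)) + 1 by omega, hy,
      locTerm_eq_eigenCoeff, eigenCoeff_succ, show n - 1 - m = n - (m + 1) by omega]
    ring

lemma sum_range_convolution_le {f g : ℕ → ℝ} (hf : ∀ n, 0 ≤ f n) (hg : ∀ n, 0 ≤ g n) (N : ℕ) :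
    ∑ n ∈ Finset.range N, ∑ j ∈ Finset.range n, f j * g (n - 1 - j)
      ≤ (∑ j ∈ Finset.range N, f j) * ∑ n ∈ Finset.range N, g n := by
  have h := Finset.sum_Ico_Ico_comm' 0 N (fun j n => f j * g (n - 1 - j))
  simp only [← Finset.range_eq_Ico] at h
  rw [← h, Finset.sum_mul]
  refine Finset.sum_le_sum fun j _ => ?_
  rw [← Finset.mul_sum, Finset.sum_Ico_eq_sum_range]
  refine mul_le_mul_of_nonneg_left ?_ (hf j)
  have e : ∀ k, j + 1 + k - 1 - j = k := fun k => by omega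
  simp only [e]
  exact Finset.sum_le_sum_of_subset_of_nonneg (Finset.range_mono (by omega)) fun _ _ _ => hg _

/-- A subcritical renewal equation has a solution tending to zero. -/
lemma tendsto_zero_of_renewal (hd : 1 ≤ d) (h0 : 0 ≤ q) (hdq : (d : ℝ) * q < 1)
    (hF : locSum d q < 1) (hy0 : ∀ n i, 0 ≤ y n i) (hstart : ∀ i, y 0 i = q ^ (i + 1))
    (hy : ∀ n i, y (n + 1) i = d * q ^ (i + 1) * y n 0 + d * (1 - q ^ (i + 1)) * y n (i + 1)) :
    Filter.Tendsto (fun n => y n 0) Filter.atTop (nhds 0) := by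
  have hq1 := le_one_of_natCast_mul_lt_one hd hdq
  have hf := locTerm_nonneg d h0 hq1
  have hsum := summable_locTerm hd h0 hdq
  have hle : ∀ N, ∑ j ∈ Finset.range N, locTerm d q j ≤ locSum d q := fun N =>
    hsum.sum_le_tsum _ fun j _ => hf j
  have hd1 : (1 : ℝ) ≤ d := by exact_mod_cast hd
  refine Summable.tendsto_atTop_zero (summable_of_sum_range_le (fun n => hy0 n 0)
    (c := locSum d q / (1 - locSum d q)) fun N => ?_)
  set Y := ∑ n ∈ Finset.range N, y n 0
  have hY0 : 0 ≤ Y := Finset.sum_nonneg fun n _ => hy0 n 0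
  -- Summing the renewal equation over `n < N` gives `Y ≤ F * Y + F` with `F` a partial sum of
  -- `locSum d q < 1`, hence a bound uniform in `N`.
  have key : Y ≤ (∑ j ∈ Finset.range N, locTerm d q j) * Y
      + ∑ j ∈ Finset.range N, locTerm d q j := by
    refine le_trans ?_ (add_le_add_left (sum_range_convolution_le hf (fun n => hy0 n 0) N) _)
    rw [← Finset.sum_add_distrib]
    refine Finset.sum_le_sum fun n _ => ?_
    rw [renewal_expand hy n n le_rfl, Nat.sub_self, hstart]
    gcongr
    -- The unreturned part is the `n`-th term of the series without its factor `d ≥ 1`.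
    rw [locTerm_eq_eigenCoeff]
    refine mul_le_mul_of_nonneg_left ?_ (eigenCoeff_nonneg d h0 hq1 n)
    exact le_mul_of_one_le_left (by positivity) hd1
  rw [le_div_iff₀ (by linarith)]
  nlinarith [hle N, mul_le_mul_of_nonneg_right (hle N) hY0]

end renewal

/-! ### Hitting functions and the truncated eigenfunction -/

/-- The probability that a vertex with `k` particles has at least one marked particle, when each
particle is marked with probability `u`. -/
def hitFun (u : ℝ) (k : ℕ) : ℝ := 1 - (1 - u) ^ k

lemma hitFun_nonneg {u : ℝ} (h0 : 0 ≤ u) (h1 : u ≤ 1) (k : ℕ) : 0 ≤ hitFun u k :=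
  sub_nonneg.2 (pow_le_one₀ (by linarith) (by linarith))

lemma hitFun_le_one {u : ℝ} (h1 : u ≤ 1) (k : ℕ) : hitFun u k ≤ 1 :=
  sub_le_self _ (pow_nonneg (by linarith) _)

lemma hitFun_zero (u : ℝ) : hitFun u 0 = 0 := by simp [hitFun]

lemma hitFun_one (u : ℝ) : hitFun u 1 = u := by simp [hitFun]

lemma le_hitFun {u : ℝ} (h0 : 0 ≤ u) (h1 : u ≤ 1) {k : ℕ} (hk : k ≠ 0) : u ≤ hitFun u k := by
  have := pow_le_of_le_one (by linarith : 0 ≤ 1 - u) (by linarith) hk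
  unfold hitFun; linarith

/-- The truncated eigenfunction. -/
noncomputable def eigenFun (d : ℕ) (q : ℝ) (m : ℕ) (k : ℕ) : ℝ :=
  ∑ i ∈ Finset.range m, eigenCoeff d q i * hitFun (q ^ (i + 1)) k

/-- The image of the truncated eigenfunction under the mean operator of the process. -/
noncomputable def meanEigenFun (d : ℕ) (q : ℝ) (m : ℕ) (k : ℕ) : ℝ :=
  ∑ i ∈ Finset.range m, eigenCoeff d q i *
    (q ^ (i + 1) * hitFun q k + (1 - q ^ (i + 1)) * hitFun (q ^ (i + 2)) k)

/-- The coefficients are chosen so that the parts moving on to the next index reproduce the sum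
shifted by one. What is left is the surplus of the returns to the first index over `1`, and one
boundary term from the truncation. -/
lemma mul_meanEigenFun (d : ℕ) (q : ℝ) (m k : ℕ) :
    d * meanEigenFun d q m k = eigenFun d q m k
      + (∑ i ∈ Finset.range m, locTerm d q i - 1) * hitFun q k
      + eigenCoeff d q m * hitFun (q ^ (m + 1)) k := by
  have e1 : d * meanEigenFun d q m k = (∑ i ∈ Finset.range m, locTerm d q i) * hitFun q k
      + ∑ i ∈ Finset.range m, eigenCoeff d q (i + 1) * hitFun (q ^ (i + 2)) k := by
    rw [meanEigenFun, Finset.mul_sum, Finset.sum_mul, ← Finset.sum_add_distrib]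
    refine Finset.sum_congr rfl fun i _ => ?_
    rw [eigenCoeff_succ, locTerm_eq_eigenCoeff]; ring
  have e2 := Finset.sum_range_succ (fun i => eigenCoeff d q i * hitFun (q ^ (i + 1)) k) m
  rw [Finset.sum_range_succ'] at e2
  simp only [eigenCoeff_zero, zero_add, pow_one, one_mul] at e2
  rw [e1, eigenFun]
  linarith

lemma eigenFun_nonneg (d : ℕ) {q : ℝ} (h0 : 0 ≤ q) (h1 : q ≤ 1) (m k : ℕ) :
    0 ≤ eigenFun d q m k :=
  Finset.sum_nonneg fun i _ => mul_nonneg (eigenCoeff_nonneg d h0 h1 i)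
    (hitFun_nonneg (by positivity) (pow_le_one₀ h0 h1) k)

lemma eigenFun_le (d : ℕ) {q : ℝ} (h0 : 0 ≤ q) (h1 : q ≤ 1) (m k : ℕ) :
    eigenFun d q m k ≤ ∑ i ∈ Finset.range m, eigenCoeff d q i :=
  Finset.sum_le_sum fun i _ => mul_le_of_le_one_right (eigenCoeff_nonneg d h0 h1 i)
    (hitFun_le_one (pow_le_one₀ h0 h1) k)

lemma eigenFun_zero (d : ℕ) (q : ℝ) (m : ℕ) : eigenFun d q m 0 = 0 := by
  simp [eigenFun, hitFun_zero]

lemma eigenFun_one_pos (d : ℕ) {q : ℝ} (h0 : 0 < q) (h1 : q ≤ 1) {m : ℕ} (hm : m ≠ 0) :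
    0 < eigenFun d q m 1 := by
  refine Finset.sum_pos' (fun i _ => mul_nonneg (eigenCoeff_nonneg d h0.le h1 i)
    (hitFun_nonneg (by positivity) (pow_le_one₀ h0.le h1) 1)) ⟨0, by simpa using by omega, ?_⟩
  simpa [eigenCoeff_zero, hitFun_one] using h0

/-- In the supercritical case a truncated eigenfunction is expanded by the mean operator. -/
lemma exists_expanding_eigenFun {d : ℕ} {q : ℝ} (h0 : 0 < q) (h1 : q ≤ 1)
    (hs : Summable (locTerm d q)) (hF : 1 < locSum d q) :
    ∃ m ≠ 0, ∃ ε > 0, ∀ k, (1 + ε) * eigenFun d q m k ≤ d * meanEigenFun d q m k := by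
  obtain ⟨m, hm⟩ := (hs.hasSum.tendsto_sum_nat.eventually_const_lt hF).exists
  have hm0 : m ≠ 0 := by rintro rfl; norm_num at hm
  set S := ∑ i ∈ Finset.range m, locTerm d q i
  set C := ∑ i ∈ Finset.range m, eigenCoeff d q i with hC
  have hC1 : 0 < C := by
    refine Finset.sum_pos' (fun i _ => eigenCoeff_nonneg d h0.le h1 i)
      ⟨0, by simpa using by omega, ?_⟩
    simp [eigenCoeff_zero]
  -- For `k ≠ 0` one has `hitFun q k ≥ q`, while the truncated eigenfunction is at most `C`; so the
  -- surplus `(S - 1) * hitFun q k` is at least this `ε` times the function.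
  refine ⟨m, hm0, (S - 1) * q / C, by have : 0 < S - 1 := by linarith
                                      positivity, fun k => ?_⟩
  rw [mul_meanEigenFun]
  have hlast : 0 ≤ eigenCoeff d q m * hitFun (q ^ (m + 1)) k :=
    mul_nonneg (eigenCoeff_nonneg d h0.le h1 m)
      (hitFun_nonneg (by positivity) (pow_le_one₀ h0.le h1) k)
  have hmid : (S - 1) * q / C * eigenFun d q m k ≤ (S - 1) * hitFun q k := by
    rcases eq_or_ne k 0 with rfl | hk
    · simp [eigenFun_zero, hitFun_zero]
    have h2 := eigenFun_le d h0.le h1 m k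
    have h3 := le_hitFun h0.le h1 hk
    calc (S - 1) * q / C * eigenFun d q m k ≤ (S - 1) * q / C * C := by
          gcongr
      _ = (S - 1) * q := by field_simp
      _ ≤ _ := by gcongr
  linarith

/-! ### Particles that have only moved away from the root -/

section occupants

variable {d : ℕ}

/-- The particles at `v` that jump in direction `i` when every particle at `v` has been moving away
from the root. The jump of the particle `x` at step `k` is `J x k`, which is `none` if `x` dies. -/
def jumpers (J : List (Fin (d + 1)) → ℕ → Option (Fin (d + 1))) (A : Finset (List (Fin (d + 1))))
    (i : Fin (d + 1)) (n : ℕ) : Finset (List (Fin (d + 1))) :=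
  -- A particle on an outward path is activated at time `|x|`, so at time `n` it makes its jump
  -- number `n - |x|`.
  A.filter fun x => J x (n - x.length) = some i

/-- The particles at the child `i :: l` of `l`, when `A` is the set of particles at `l`. -/
def childOccupants (J : List (Fin (d + 1)) → ℕ → Option (Fin (d + 1)))
    (A : Finset (List (Fin (d + 1)))) (i : Fin (d + 1)) (l : List (Fin (d + 1))) :
    Finset (List (Fin (d + 1))) :=
  if (jumpers J A i l.length).Nonempty then insert (i :: l) (jumpers J A i l.length) else ∅

/-- The active particles at the vertex `v` at time `|v|`. -/
def occupants (J : List (Fin (d + 1)) → ℕ → Option (Fin (d + 1))) :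
    List (Fin (d + 1)) → Finset (List (Fin (d + 1)))
  | [] => {[]}
  | i :: l => childOccupants J (occupants J l) i l

variable {J J' : List (Fin (d + 1)) → ℕ → Option (Fin (d + 1))}

lemma mem_jumpers {A : Finset (List (Fin (d + 1)))} {i : Fin (d + 1)} {n : ℕ}
    {x : List (Fin (d + 1))} : x ∈ jumpers J A i n ↔ x ∈ A ∧ J x (n - x.length) = some i := by
  simp [jumpers]

lemma mem_childOccupants {A : Finset (List (Fin (d + 1)))} {i : Fin (d + 1)}
    {l x : List (Fin (d + 1))} : x ∈ childOccupants J A i l ↔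
      x ∈ jumpers J A i l.length ∨ (x = i :: l ∧ (jumpers J A i l.length).Nonempty) := by
  unfold childOccupants
  split_ifs with h
  · simp [h, or_comm]
  · simp only [Finset.not_nonempty_iff_eq_empty] at h
    simp [h]

lemma childOccupants_nonempty {A : Finset (List (Fin (d + 1)))} {i : Fin (d + 1)}
    {l : List (Fin (d + 1))} :
    (childOccupants J A i l).Nonempty ↔ (jumpers J A i l.length).Nonempty := by
  unfold childOccupants
  split_ifs with h <;> simp [h]

lemma occupants_nil : occupants J [] = {[]} := rfl

lemma occupants_cons (i : Fin (d + 1)) (l : List (Fin (d + 1))) :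
    occupants J (i :: l) = childOccupants J (occupants J l) i l := rfl

lemma isSuffix_of_mem_occupants {v x : List (Fin (d + 1))} (h : x ∈ occupants J v) : x <:+ v := by
  induction v with
  | nil => simp_all [occupants_nil]
  | cons i l ih =>
    rw [occupants_cons, mem_childOccupants, mem_jumpers] at h
    rcases h with h | h
    · exact (ih h.1).trans (List.suffix_cons i l)
    · rw [h.1]

lemma occupants_nonempty_tail {v : List (Fin (d + 1))} (h : (occupants J v).Nonempty) :
    (occupants J v.tail).Nonempty := by
  cases v with
  | nil => exact h
  | cons i l =>
    rw [occupants_cons, childOccupants_nonempty] at h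
    obtain ⟨x, hx⟩ := h
    exact ⟨x, (mem_jumpers.1 hx).1⟩

/-- A particle is at one place only. -/
lemma eq_of_mem_occupants {v w x : List (Fin (d + 1))} (hvw : v.length = w.length)
    (hv : x ∈ occupants J v) (hw : x ∈ occupants J w) : v = w := by
  induction v generalizing w with
  | nil => exact (List.length_eq_zero_iff.1 hvw.symm).symm
  | cons i l ih =>
    cases w with
    | nil => simp at hvw
    | cons i' l' =>
      have hl : l.length = l'.length := by simpa using hvw
      have h1 := (isSuffix_of_mem_occupants hv)
      have h2 := (isSuffix_of_mem_occupants hw)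
      rw [occupants_cons, mem_childOccupants, mem_jumpers] at hv hw
      rcases hv with hv | ⟨rfl, -⟩
      · rcases hw with hw | ⟨rfl, -⟩
        · obtain rfl := ih hl hv.1 hw.1
          have := hv.2.symm.trans hw.2
          simp_all
        · exact (h1.eq_of_length hvw.symm).symm
      · exact h2.eq_of_length hvw

/-- Only the jumps of a particle before its death matter. -/
lemma occupants_congr {v : List (Fin (d + 1))}
    (h : ∀ x, x <:+ v → ∀ k, x.length + k < v.length → (∀ j < k, J x j ≠ none) → J' x k = J x k) :
    occupants J' v = occupants J v ∧
      ∀ x ∈ occupants J v, ∀ k, x.length + k < v.length → J x k ≠ none := by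
  induction v with
  | nil => simp [occupants_nil]
  | cons i l ih =>
    obtain ⟨h1, h2⟩ := ih fun x hx k hk hj =>
      h x (hx.trans (List.suffix_cons i l)) k (by simp; omega) hj
    have hJ : jumpers J' (occupants J l) i l.length = jumpers J (occupants J l) i l.length := by
      refine Finset.filter_congr fun x hx => ?_
      have hs := isSuffix_of_mem_occupants hx
      have hlen := hs.length_le
      -- An occupant of `l` has survived all its earlier jumps; carrying this as the second conjunct
      -- of the induction makes `h` applicable to the current jump.
      rw [h x (hs.trans (List.suffix_cons i l)) _ (by simp; omega)
        fun j hj => h2 x hx j (by omega)]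
    refine ⟨by rw [occupants_cons, occupants_cons, h1, childOccupants, childOccupants, hJ], ?_⟩
    intro x hx k hk
    rw [occupants_cons, mem_childOccupants, mem_jumpers] at hx
    rcases hx with hx | ⟨rfl, -⟩
    · have hlen := (isSuffix_of_mem_occupants hx.1).length_le
      simp only [List.length_cons] at hk
      rcases (by omega : x.length + k < l.length ∨ k = l.length - x.length) with hk' | rfl
      · exact h2 x hx.1 k hk'
      · simp [hx.2]
    · omega

end occupants

/-! ### Levels of the tree -/

section level

/-- The words of length `n` that are vertices of the tree. -/
def level (d : ℕ) : ℕ → Finset (List (Fin (d + 1)))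
  | 0 => {[]}
  | n + 1 => (level d n).biUnion fun l =>
      (Finset.univ.filter fun i => l.head? ≠ some i).image fun i => i :: l

variable {d : ℕ}

lemma isChain_cons_iff_head? {i : Fin (d + 1)} {l : List (Fin (d + 1))} :
    (i :: l).IsChain (fun a b => a ≠ b) ↔
      l.head? ≠ some i ∧ l.IsChain (fun a b => a ≠ b) := by
  rw [List.isChain_cons]
  refine and_congr_left fun _ => ⟨fun h hl => h i hl rfl, fun h b hb hib => h (hib ▸ hb)⟩

lemma mem_level {n : ℕ} {v : List (Fin (d + 1))} :
    v ∈ level d n ↔ v.length = n ∧ v.IsChain (fun a b => a ≠ b) := by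
  induction n generalizing v with
  | zero => simp +contextual [level, List.length_eq_zero_iff]
  | succ n ih =>
    simp only [level, Finset.mem_biUnion, Finset.mem_image, Finset.mem_filter, Finset.mem_univ,
      true_and]
    constructor
    · rintro ⟨l, hl, i, hi, rfl⟩
      exact ⟨by simp [(ih.1 hl).1], isChain_cons_iff_head?.2 ⟨hi, (ih.1 hl).2⟩⟩
    · rintro ⟨h1, h2⟩
      cases v with
      | nil => simp at h1
      | cons i l =>
        obtain ⟨h3, h4⟩ := isChain_cons_iff_head?.1 h2
        exact ⟨l, ih.2 ⟨by simpa using h1, h4⟩, i, h3, rfl⟩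

/-- The directions leading away from the root. -/
def awayDirections (l : List (Fin (d + 1))) : Finset (Fin (d + 1)) :=
  Finset.univ.filter fun i => l.head? ≠ some i

lemma awayDirections_nil : awayDirections ([] : List (Fin (d + 1))) = Finset.univ := by
  simp [awayDirections]

lemma card_awayDirections_cons (a : Fin (d + 1)) (l : List (Fin (d + 1))) :
    (awayDirections (a :: l)).card = d := by
  have : awayDirections (a :: l) = Finset.univ.erase a := by
    ext i; simp [awayDirections, eq_comm]
  rw [this, Finset.card_erase_of_mem (Finset.mem_univ _)]
  simp

lemma le_card_awayDirections (l : List (Fin (d + 1))) : d ≤ (awayDirections l).card := by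
  cases l with
  | nil => simp [awayDirections_nil]
  | cons a l => rw [card_awayDirections_cons]

lemma prod_level_succ {M : Type*} [CommMonoid M] (n : ℕ) (f : List (Fin (d + 1)) → M) :
    ∏ v ∈ level d (n + 1), f v = ∏ l ∈ level d n, ∏ i ∈ awayDirections l, f (i :: l) := by
  rw [level, Finset.prod_biUnion]
  · refine Finset.prod_congr rfl fun l _ => ?_
    rw [Finset.prod_image (by simp)]
    rfl
  · intro l _ l' _ hll
    refine Finset.disjoint_left.2 fun v hv hv' => hll ?_
    simp only [Finset.mem_image, Finset.mem_filter, Finset.mem_univ, true_and] at hv hv'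
    obtain ⟨i, -, rfl⟩ := hv
    obtain ⟨i', -, h⟩ := hv'
    simp_all

lemma card_level_le (hd : 1 ≤ d) (n : ℕ) : (level d n).card ≤ 2 * d ^ n := by
  have h : ∀ n, (level d (n + 1)).card ≤ (d + 1) * d ^ n := by
    intro n
    induction n with
    | zero =>
      rw [level]
      refine Finset.card_biUnion_le.trans ?_
      simpa [level] using Finset.card_image_le.trans (by simp)
    | succ n ih =>
      rw [level]
      refine Finset.card_biUnion_le.trans ?_
      refine (Finset.sum_le_card_nsmul _ _ d fun l hl => ?_).trans ?_
      · refine Finset.card_image_le.trans ?_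
        obtain ⟨h1, -⟩ := mem_level.1 hl
        cases l with
        | nil => simp at h1
        | cons a l => exact (card_awayDirections_cons a l).le
      · rw [smul_eq_mul, pow_succ, ← mul_assoc]
        exact Nat.mul_le_mul_right d ih
  cases n with
  | zero => simp [level]
  | succ n =>
    refine (h n).trans ?_
    rw [pow_succ', ← mul_assoc]
    exact Nat.mul_le_mul_right _ (by omega)

end level

/-! ### Reduction of the dynamics to outward motion -/

section dynamics

variable {d : ℕ}

open Classical in
/-- The jumps of the particles: `none` from the end of the lifetime on. -/
noncomputable def jumpOf (ω : Outcome d) (x : List (Fin (d + 1))) (k : ℕ) :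
    Option (Fin (d + 1)) :=
  if h : x.IsChain (fun a b => a ≠ b) then
    if k < lifetime ω ⟨x, h⟩ then some ((ω ⟨x, h⟩).2 k) else none
  else none

lemma jumpOf_eq_some {ω : Outcome d} {x : Vertex d} {k : ℕ} {i : Fin (d + 1)} :
    jumpOf ω x.1 k = some i ↔ k < lifetime ω x ∧ (ω x).2 k = i := by
  simp [jumpOf, x.2]

lemma walk_of_mem_occupants (ω : Outcome d) (x v : Vertex d)
    (h : x.1 ∈ occupants (jumpOf ω) v.1) : walk ω x (v.1.length - x.1.length) = v := by
  obtain ⟨v, hv⟩ := v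
  induction v with
  | nil =>
    have : x = ⟨[], hv⟩ := Subtype.ext (by simpa [occupants_nil] using h)
    subst this
    rfl
  | cons i l ih =>
    obtain ⟨h1, h2⟩ := isChain_cons_iff_head?.1 hv
    simp only [occupants_cons, mem_childOccupants, mem_jumpers] at h
    rcases h with h | ⟨h, -⟩
    · have hlen := (isSuffix_of_mem_occupants h.1).length_le
      have e : (i :: l).length - x.1.length = (l.length - x.1.length) + 1 := by simp; omega
      simp only [e, walk]
      have := ih h2 h.1
      simp only at this
      rw [this, (jumpOf_eq_some.1 h.2).2]
      exact Subtype.ext (by rw [neighbor_val, if_neg h1])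
    · simp only [h, Nat.sub_self, walk]
      exact Subtype.ext h

/-- A jump towards the root reaches the parent of an occupied vertex, which has been visited; a jump
away from the root reaches level `t + 1`, where nothing has been visited by time `t`. So survivors
and newly activated particles are exactly the occupants of level `t + 1`. -/
lemma stateAt_eq (ω : Outcome d) (t : ℕ) :
    (stateAt ω t).visited = {v | v.1.length ≤ t ∧ (occupants (jumpOf ω) v.1).Nonempty} ∧
    (stateAt ω t).active = {a | a.1.1.length + a.2 = t ∧ (walk ω a.1 a.2).1.length = t ∧
      a.1.1 ∈ occupants (jumpOf ω) (walk ω a.1 a.2).1} := by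
  induction t with
  | zero =>
    simp only [stateAt, initialState]
    constructor
    · ext v
      simp only [Set.mem_singleton_iff, nonpos_iff_eq_zero, List.length_eq_zero_iff,
        Set.mem_ofPred_eq]
      constructor
      · rintro rfl; simp [root, occupants_nil]
      · exact fun h => Subtype.ext h.1
    · ext ⟨x, n⟩
      simp only [Set.mem_singleton_iff, Prod.mk.injEq, Nat.add_eq_zero_iff,
        List.length_eq_zero_iff, Set.mem_ofPred_eq]
      constructor
      · rintro ⟨rfl, rfl⟩; simp [root, occupants_nil, walk]
      · rintro ⟨⟨h1, h2⟩, -⟩; exact ⟨Subtype.ext h1, h2⟩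
  | succ t ih =>
    obtain ⟨ihv, iha⟩ := ih
    have hfresh : ∀ (x : Vertex d) (n : ℕ), (x, n) ∈ (stateAt ω t).active →
        walk ω x (n + 1) ∉ (stateAt ω t).visited →
        (walk ω x (n + 1)).1 = (ω x).2 n :: (walk ω x n).1 := by
      intro x n hx hv
      rw [ihv] at hv
      rw [iha] at hx
      obtain ⟨h1, h2, h3⟩ := hx
      simp only [walk, Set.mem_ofPred_eq, neighbor_val] at *
      split_ifs at hv ⊢ with h
      -- An inward jump lands on the tail of an occupied word, contradicting that the target is not
      -- visited.
      · exact absurd ⟨by simp; omega, occupants_nonempty_tail ⟨_, h3⟩⟩ hv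
      · rfl
    have htarget : ∀ y : Vertex d, y ∈ jumpTargets ω (stateAt ω t) →
        y ∉ (stateAt ω t).visited →
        y.1.length = t + 1 ∧ (occupants (jumpOf ω) y.1).Nonempty := by
      rintro y ⟨x, n, hx, hn, rfl⟩ hy
      rw [hfresh x n hx hy]
      rw [iha] at hx
      obtain ⟨h1, h2, h3⟩ := hx
      simp only at h1 h2 h3
      have e : (walk ω x n).1.length - x.1.length = n := by omega
      refine ⟨by simp [h2], ?_⟩
      rw [occupants_cons, childOccupants_nonempty]
      exact ⟨x.1, mem_jumpers.2 ⟨h3, by rw [e]; exact jumpOf_eq_some.2 ⟨hn, rfl⟩⟩⟩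
    have htarget' : ∀ y : Vertex d, y.1.length = t + 1 → (occupants (jumpOf ω) y.1).Nonempty →
        y ∈ jumpTargets ω (stateAt ω t) ∧ y ∉ (stateAt ω t).visited := by
      rintro ⟨y, hy⟩ hlen hne
      refine ⟨?_, fun h => ?_⟩
      swap
      · rw [ihv] at h; exact absurd h.1 (by simp at hlen ⊢; omega)
      cases y with
      | nil => simp at hlen
      | cons i l =>
        rw [occupants_cons, childOccupants_nonempty] at hne
        obtain ⟨x, hx⟩ := hne
        obtain ⟨hx1, hx2⟩ := mem_jumpers.1 hx
        obtain ⟨hc1, hc2⟩ := isChain_cons_iff_head?.1 hy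
        have hs := isSuffix_of_mem_occupants hx1
        have hxc : x.IsChain (fun a b => a ≠ b) := hc2.suffix hs
        have hl : l.length = t := by simpa using hlen
        have hw := walk_of_mem_occupants ω ⟨x, hxc⟩ ⟨l, hc2⟩ hx1
        simp only at hw
        have hj := (jumpOf_eq_some (x := ⟨x, hxc⟩)).1 hx2
        refine ⟨⟨x, hxc⟩, l.length - x.length, ?_, hj.1, ?_⟩
        · rw [iha]
          refine ⟨?_, ?_, ?_⟩
          · have := hs.length_le; simp only; omega
          · rw [hw]; exact hl
          · rw [hw]; exact hx1
        · rw [walk, hw, hj.2]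
          exact Subtype.ext (by rw [neighbor_val, if_neg hc1])
    constructor
    · ext v
      simp only [stateAt, step, Set.mem_union, Set.mem_ofPred_eq]
      constructor
      · intro h
        by_cases hv : v ∈ (stateAt ω t).visited
        · rw [ihv] at hv; exact ⟨by have := hv.1; omega, hv.2⟩
        · have := htarget v (h.resolve_left hv) hv
          exact ⟨this.1.le, this.2⟩
      · rintro ⟨h1, h2⟩
        rcases (by omega : v.1.length ≤ t ∨ v.1.length = t + 1) with h | h
        · left; rw [ihv]; exact ⟨h, h2⟩
        · right; exact (htarget' v h h2).1
    · ext ⟨x, n⟩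
      simp only [stateAt, step, Set.mem_union, Set.mem_ofPred_eq, Prod.mk.injEq]
      constructor
      · rintro (⟨x', n', hx, hn, hv, rfl, rfl⟩ | ⟨y, hy, hv, rfl, rfl⟩)
        · rw [hfresh _ _ hx hv]
          rw [iha] at hx
          obtain ⟨h1, h2, h3⟩ := hx
          simp only at h1 h2 h3
          have e : (walk ω x n').1.length - x.1.length = n' := by omega
          refine ⟨by omega, by simp [h2], ?_⟩
          rw [occupants_cons, mem_childOccupants, mem_jumpers]
          exact Or.inl ⟨h3, by rw [e]; exact jumpOf_eq_some.2 ⟨hn, rfl⟩⟩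
        · obtain ⟨h1, h2⟩ := htarget _ hy hv
          refine ⟨by omega, h1, ?_⟩
          simp only [walk]
          obtain ⟨y, hyc⟩ := x
          cases y with
          | nil => simp at h1
          | cons i l =>
            rw [occupants_cons, childOccupants_nonempty] at h2
            rw [occupants_cons, mem_childOccupants]
            exact Or.inr ⟨rfl, h2⟩
      · rintro ⟨h1, h2, h3⟩
        cases n with
        | zero =>
          right
          simp only [walk] at h2 h3
          obtain ⟨h4, h5⟩ := htarget' x h2 ⟨_, h3⟩
          exact ⟨x, h4, h5, rfl, rfl⟩
        | succ n =>
          left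
          refine ⟨x, n, ?_⟩
          obtain ⟨-, hv⟩ := htarget' _ h2 ⟨_, h3⟩
          have hlen := (isSuffix_of_mem_occupants h3).length_le
          generalize hy : walk ω x (n + 1) = y at *
          obtain ⟨y, hyc⟩ := y
          cases y with
          | nil => simp at h2
          | cons i l =>
            obtain ⟨hc1, hc2⟩ := isChain_cons_iff_head?.1 hyc
            simp only [occupants_cons, mem_childOccupants, mem_jumpers] at h3
            have hl : l.length = t := by simpa using h2
            rcases h3 with h3 | ⟨h3, -⟩
            · have hw := walk_of_mem_occupants ω x ⟨l, hc2⟩ h3.1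
              have hn : l.length - x.1.length = n := by omega
              simp only [hn] at hw h3
              refine ⟨?_, (jumpOf_eq_some.1 h3.2).1, hv, rfl, rfl⟩
              rw [iha]
              refine ⟨by simp only; omega, ?_, ?_⟩ <;> simp only [hw]
              · exact hl
              · exact h3.1
            · have := congrArg List.length h3
              simp at this; omega

lemma mem_survival_iff (ω : Outcome d) :
    ω ∈ survival d ↔ ∀ t, ∃ v ∈ level d t, (occupants (jumpOf ω) v).Nonempty := by
  refine forall_congr' fun t => ?_
  rw [(stateAt_eq ω t).2]
  constructor
  · rintro ⟨⟨x, n⟩, -, h2, h3⟩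
    exact ⟨_, mem_level.2 ⟨h2, (walk ω x n).2⟩, _, h3⟩
  · rintro ⟨v, hv, x, hx⟩
    obtain ⟨h1, h2⟩ := mem_level.1 hv
    have hs := isSuffix_of_mem_occupants hx
    have hw := walk_of_mem_occupants ω ⟨x, h2.suffix hs⟩ ⟨v, h2⟩ hx
    have := hs.length_le
    simp only at hw
    exact ⟨(⟨x, h2.suffix hs⟩, v.length - x.length), by simp only; omega, by rw [hw]; exact h1,
      by rw [hw]; exact hx⟩

end dynamics

/-! ### Independence of finite blocks of coordinates -/

section field

/-- Over a finite alphabet, a function of finitely many coordinates factors through a finite type,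
where measurability and integrability are automatic. -/
lemma exists_comp_restrict {I α β : Type*} [Nonempty α] {P : Finset I} {f : (I → α) → β}
    (hf : DependsOn f (P : Set I)) : ∃ g : (P → α) → β, ∀ ξ, f ξ = g (P.restrict ξ) := by
  classical
  refine ⟨fun a => f fun i => if h : i ∈ P then a ⟨i, h⟩ else Classical.arbitrary α, fun ξ => ?_⟩
  exact hf fun i hi => by simp [Finset.mem_coe.1 hi]

variable {I α V : Type*} [Finite α] [Nonempty α] [MeasurableSpace α] [MeasurableSingletonClass α]

lemma measurable_of_dependsOn {β : Type*} [MeasurableSpace β] {P : Finset I} {f : (I → α) → β}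
    (hf : DependsOn f (P : Set I)) : Measurable f := by
  obtain ⟨g, hg⟩ := exists_comp_restrict hf
  have : f = g ∘ P.restrict := funext hg
  rw [this]
  exact (measurable_of_finite g).comp (Finset.measurable_restrict P)

variable (κ : Measure α) [IsProbabilityMeasure κ]

lemma integrable_of_dependsOn {P : Finset I} {f : (I → α) → ℝ} (hf : DependsOn f (P : Set I)) :
    Integrable f (Measure.infinitePi fun _ : I => κ) := by
  obtain ⟨g, hg⟩ := exists_comp_restrict hf
  obtain ⟨C, hC⟩ := (Set.finite_range fun a => ‖g a‖).bddAbove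
  exact Integrable.of_bound (measurable_of_dependsOn hf).aestronglyMeasurable C
    (Filter.Eventually.of_forall fun ξ => by rw [hg]; exact hC ⟨_, rfl⟩)

/-- Integration over a product measure can be carried out one block of coordinates at a time. -/
lemma integral_decouple {P L : Finset I} (hPL : Disjoint P L) {G : (I → α) → (I → α) → ℝ}
    (hP : ∀ η, DependsOn (fun ξ => G ξ η) (P : Set I))
    (hL : ∀ ξ, DependsOn (G ξ) (L : Set I)) :
    ∫ ξ, G ξ ξ ∂(Measure.infinitePi fun _ : I => κ) =
      ∫ ξ, ∫ η, G ξ η ∂(Measure.infinitePi fun _ : I => κ) ∂(Measure.infinitePi fun _ : I => κ) := by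
  classical
  set ρ := Measure.infinitePi fun _ : I => κ
  let ext (S : Finset I) (a : S → α) : I → α :=
    fun i => if h : i ∈ S then a ⟨i, h⟩ else Classical.arbitrary α
  let g (a : P → α) (b : L → α) : ℝ := G (ext P a) (ext L b)
  have hG : ∀ ξ η, G ξ η = g (P.restrict ξ) (L.restrict η) := fun ξ η => by
    have h1 : G ξ η = G (ext P (P.restrict ξ)) η :=
      hP η fun i hi => by simp [ext, Finset.mem_coe.1 hi]
    rw [h1]
    exact hL _ fun i hi => by simp [ext, Finset.mem_coe.1 hi]
  -- Restrictions to disjoint blocks are independent, so their joint law is a product and Fubini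
  -- applies.
  have hind : IndepFun (fun ξ : I → α => P.restrict ξ) (fun ξ => L.restrict ξ) ρ :=
    (iIndepFun_infinitePi (P := fun _ : I => κ) (X := fun _ x => x)
      fun _ => measurable_id).indepFun_finset P L hPL fun i => measurable_pi_apply i
  have mP : Measurable (P.restrict : (I → α) → (P → α)) := Finset.measurable_restrict P
  have mL : Measurable (L.restrict : (I → α) → (L → α)) := Finset.measurable_restrict L
  have : IsProbabilityMeasure (ρ.map P.restrict) :=
    Measure.isProbabilityMeasure_map mP.aemeasurable
  have : IsProbabilityMeasure (ρ.map L.restrict) :=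
    Measure.isProbabilityMeasure_map mL.aemeasurable
  have hmap := (indepFun_iff_map_prod_eq_prod_map_map mP.aemeasurable mL.aemeasurable).1 hind
  simp only [hG]
  calc ∫ ξ, g (P.restrict ξ) (L.restrict ξ) ∂ρ
      = ∫ z, g z.1 z.2 ∂(ρ.map fun ξ => (P.restrict ξ, L.restrict ξ)) := by
        rw [integral_map (mP.prodMk mL).aemeasurable
          (measurable_of_finite _).aestronglyMeasurable]
    _ = ∫ a, ∫ b, g a b ∂(ρ.map L.restrict) ∂(ρ.map P.restrict) := by
        rw [hmap, integral_prod _ (Integrable.of_finite)]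
    _ = _ := by
        rw [integral_map mP.aemeasurable (measurable_of_finite _).aestronglyMeasurable]
        refine integral_congr_ae (Filter.Eventually.of_forall fun ξ => ?_)
        exact integral_map mL.aemeasurable (measurable_of_finite _).aestronglyMeasurable

/-- Functions of disjoint finite blocks of coordinates are independent. -/
lemma integral_prod_of_dependsOn {s : Finset V} {A : V → Finset I}
    (hA : (s : Set V).PairwiseDisjoint A) {f : V → (I → α) → ℝ}
    (hf : ∀ v ∈ s, DependsOn (f v) (A v : Set I)) :
    ∫ ξ, ∏ v ∈ s, f v ξ ∂(Measure.infinitePi fun _ : I => κ) =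
      ∏ v ∈ s, ∫ ξ, f v ξ ∂(Measure.infinitePi fun _ : I => κ) := by
  classical
  induction s using Finset.induction_on with
  | empty => simp
  | insert w s hw ih =>
    have hdisj : Disjoint (A w) (s.biUnion A) := by
      rw [Finset.disjoint_biUnion_right]
      exact fun v hv => hA (by simp) (by simp [hv]) (by rintro rfl; exact hw hv)
    simp only [Finset.prod_insert hw]
    rw [integral_decouple κ (G := fun ξ η => f w ξ * ∏ v ∈ s, f v η) hdisj]
    · simp only [integral_const_mul, integral_mul_const]
      rw [ih (hA.subset (by simp)) fun v hv => hf v (by simp [hv])]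
    · intro η ξ ξ' h
      simp only [hf w (by simp) h]
    · intro ξ η η' h
      simp only
      congr 1
      refine Finset.prod_congr rfl fun v hv => hf v (by simp [hv]) fun i hi => h i ?_
      exact Finset.mem_coe.2 (Finset.mem_biUnion.2 ⟨v, hv, hi⟩)

end field

/-! ### One-step expectations of hitting functions -/

section process

variable {d : ℕ} {α : Type*} {j : α → Option (Fin (d + 1))} {q : ℝ}

/-- The jumps encoded by a field of independent variables. -/
def fieldJump (j : α → Option (Fin (d + 1))) (ξ : List (Fin (d + 1)) × ℕ → α)
    (x : List (Fin (d + 1))) (k : ℕ) : Option (Fin (d + 1)) := j (ξ (x, k))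

/-- The coordinates used before time `n`. -/
noncomputable def pastIndices (d n : ℕ) : Finset (List (Fin (d + 1)) × ℕ) :=
  ((List.finite_length_le (Fin (d + 1)) n).toFinset ×ˢ Finset.range (n + 1)).filter
    fun a => a.1.length + a.2 < n

/-- The coordinates used at time `n`. -/
noncomputable def currentIndices (d n : ℕ) : Finset (List (Fin (d + 1)) × ℕ) :=
  ((List.finite_length_le (Fin (d + 1)) n).toFinset ×ˢ Finset.range (n + 1)).filter
    fun a => a.1.length + a.2 = n

lemma mem_pastIndices {n : ℕ} {a : List (Fin (d + 1)) × ℕ} :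
    a ∈ pastIndices d n ↔ a.1.length + a.2 < n := by
  simp [pastIndices]; omega

lemma mem_currentIndices {n : ℕ} {a : List (Fin (d + 1)) × ℕ} :
    a ∈ currentIndices d n ↔ a.1.length + a.2 = n := by
  simp [currentIndices]; omega

lemma disjoint_pastIndices_currentIndices (n : ℕ) :
    Disjoint (pastIndices d n) (currentIndices d n) :=
  Finset.disjoint_left.2 fun a h1 h2 => by
    rw [mem_pastIndices] at h1; rw [mem_currentIndices] at h2; omega

/-- The coordinates used at time `n` by the particles in `A`. -/
def jumpIndices (A : Finset (List (Fin (d + 1)))) (n : ℕ) : Finset (List (Fin (d + 1)) × ℕ) :=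
  A.image fun x => (x, n - x.length)

lemma dependsOn_occupants (v : List (Fin (d + 1))) :
    DependsOn (fun ξ => occupants (fieldJump j ξ) v) (pastIndices d v.length : Set _) :=
  fun ξ ξ' h => ((occupants_congr (J := fieldJump j ξ) (J' := fieldJump j ξ') fun x _ k hk _ => by
    simp only [fieldJump]; rw [h (x, k) (Finset.mem_coe.2 (mem_pastIndices.2 hk))]).1).symm

lemma dependsOn_jumpers (A : Finset (List (Fin (d + 1)))) (i : Fin (d + 1)) (n : ℕ) :
    DependsOn (fun ξ => jumpers (fieldJump j ξ) A i n) (jumpIndices A n : Set _) :=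
  fun ξ ξ' h => Finset.filter_congr fun x hx => by
    simp only [fieldJump]
    rw [h (x, n - x.length) (Finset.mem_coe.2 (Finset.mem_image_of_mem _ hx))]

lemma dependsOn_childOccupants (A : Finset (List (Fin (d + 1)))) (i : Fin (d + 1))
    (l : List (Fin (d + 1))) :
    DependsOn (fun ξ => childOccupants (fieldJump j ξ) A i l)
      (jumpIndices A l.length : Set _) := fun ξ ξ' h => by
  have := dependsOn_jumpers (j := j) A i l.length h
  simp only at this
  simp only [childOccupants, this]

lemma jumpIndices_subset {A : Finset (List (Fin (d + 1)))} {n : ℕ} (hA : ∀ x ∈ A, x.length ≤ n) :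
    jumpIndices A n ⊆ currentIndices d n := by
  intro a ha
  obtain ⟨x, hx, rfl⟩ := Finset.mem_image.1 ha
  have := hA x hx
  exact mem_currentIndices.2 (by simp only; omega)

lemma length_le_of_mem_occupants {J : List (Fin (d + 1)) → ℕ → Option (Fin (d + 1))}
    {v x : List (Fin (d + 1))} (h : x ∈ occupants J v) : x.length ≤ v.length :=
  (isSuffix_of_mem_occupants h).length_le

variable [Finite α] [MeasurableSpace α] [MeasurableSingletonClass α]
  {κ : Measure α} [IsProbabilityMeasure κ]

/-- The law of the field. -/
noncomputable abbrev fieldLaw (d : ℕ) (κ : Measure α) [IsProbabilityMeasure κ] :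
    Measure (List (Fin (d + 1)) × ℕ → α) := Measure.infinitePi fun _ => κ

lemma integral_jump (hκ : ∀ i, κ.real {a | j a = some i} = q) (i : Fin (d + 1)) (s : ℝ)
    (a : List (Fin (d + 1)) × ℕ) :
    ∫ ξ, (if j (ξ a) = some i then s else 1) ∂(fieldLaw d κ) = 1 - q + q * s := by
  have h := measurePreserving_eval_infinitePi (fun _ : List (Fin (d + 1)) × ℕ => κ) a
  have h2 := integral_map (μ := fieldLaw d κ) h.measurable.aemeasurable
    (f := fun b : α => if j b = some i then s else 1)
    (measurable_of_finite _).aestronglyMeasurable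
  rw [h.map_eq] at h2
  simp only [Function.eval] at h2
  rw [← h2]
  have hm : MeasurableSet {b | j b = some i} := Set.Finite.measurableSet (Set.toFinite _)
  have e : (fun b : α => if j b = some i then s else 1)
      = fun b => 1 + {b | j b = some i}.indicator (fun _ => s - 1) b := by
    funext b
    by_cases hb : j b = some i <;> simp [hb]
  rw [e, integral_add (integrable_const _) ((integrable_const _).indicator hm),
    integral_indicator_const _ hm, hκ]
  simp
  ring

variable [Nonempty α]

/-- Distinct particles use distinct coordinates, so the number of jumpers is binomial; this is its
generating function. -/
lemma integral_pow_card_jumpers (hκ : ∀ i, κ.real {a | j a = some i} = q)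
    (A : Finset (List (Fin (d + 1)))) (i : Fin (d + 1)) (n : ℕ) (s : ℝ) :
    ∫ ξ, s ^ (jumpers (fieldJump j ξ) A i n).card ∂(fieldLaw d κ) = (1 - q + q * s) ^ A.card := by
  have e : ∀ ξ : List (Fin (d + 1)) × ℕ → α, s ^ (jumpers (fieldJump j ξ) A i n).card
      = ∏ x ∈ A, if j (ξ (x, n - x.length)) = some i then s else 1 := fun ξ => by
    rw [Finset.prod_ite, Finset.prod_const, Finset.prod_const_one, mul_one]
    rfl
  simp only [e]
  rw [integral_prod_of_dependsOn κ (A := fun x => {(x, n - x.length)})]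
  · simp only [integral_jump hκ, Finset.prod_const]
  · intro x _ y _ hxy
    simp only [Function.onFun, Finset.disjoint_singleton]
    exact fun h => hxy (congrArg Prod.fst h)
  · intro x _ ξ ξ' h
    simp only [h (x, n - x.length) (by simp)]

/-- The term with `0 ^ B`, which is `1` exactly when `B = 0`, removes the contribution of the
child's own particle when nobody arrives, so that both cases share one formula in powers of the form
`s ^ B`. -/
lemma hitFun_card_childOccupants {J : List (Fin (d + 1)) → ℕ → Option (Fin (d + 1))}
    {A : Finset (List (Fin (d + 1)))} {l : List (Fin (d + 1))} (hA : ∀ x ∈ A, x.length ≤ l.length)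
    (i : Fin (d + 1)) (u : ℝ) :
    hitFun u (childOccupants J A i l).card = 1 - (1 - u) * (1 - u) ^ (jumpers J A i l.length).card
      - u * 0 ^ (jumpers J A i l.length).card := by
  unfold childOccupants
  split_ifs with h
  · rw [Finset.card_insert_of_notMem, hitFun, zero_pow h.card_pos.ne']
    · ring
    · intro hmem
      have := hA _ (mem_jumpers.1 hmem).1
      simp at this
  · rw [Finset.not_nonempty_iff_eq_empty] at h
    simp [h, hitFun]

/-- The generating function is needed only at `s = 1 - u` and `s = 0`, which produce the parameters
`q * u` and `q`. Thus the hitting functions are closed under the mean operator. -/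
lemma integral_hitFun_childOccupants (hκ : ∀ i, κ.real {a | j a = some i} = q)
    {A : Finset (List (Fin (d + 1)))} {l : List (Fin (d + 1))} (hA : ∀ x ∈ A, x.length ≤ l.length)
    (i : Fin (d + 1)) (u : ℝ) :
    ∫ ξ, hitFun u (childOccupants (fieldJump j ξ) A i l).card ∂(fieldLaw d κ)
      = u * hitFun q A.card + (1 - u) * hitFun (q * u) A.card := by
  simp only [hitFun_card_childOccupants hA]
  have hint : ∀ s : ℝ, Integrable (fun ξ => s ^ (jumpers (fieldJump j ξ) A i l.length).card)
      (fieldLaw d κ) := fun s => integrable_of_dependsOn κ (P := jumpIndices A l.length)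
    fun ξ ξ' h => by
      have := dependsOn_jumpers (j := j) A i l.length h
      simp only at this
      simp only [this]
  have hint' : Integrable (fun ξ => 1 - (1 - u) * (1 - u) ^ (jumpers (fieldJump j ξ) A i
      l.length).card) (fieldLaw d κ) := (integrable_const _).sub ((hint _).const_mul _)
  rw [integral_sub hint' ((hint _).const_mul _),
    integral_sub (integrable_const _) ((hint _).const_mul _), integral_const_mul,
    integral_const_mul, integral_pow_card_jumpers hκ, integral_pow_card_jumpers hκ]
  simp only [integral_const, probReal_univ, smul_eq_mul, hitFun]
  ring

/-- The expectation of `hitFun u` of the number of particles at a vertex of level `n`. -/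
def meanHit (q : ℝ) : ℕ → ℝ → ℝ
  | 0, u => u
  | n + 1, u => u * meanHit q n q + (1 - u) * meanHit q n (q * u)

lemma meanHit_nonneg (h0 : 0 ≤ q) (h1 : q ≤ 1) (n : ℕ) {u : ℝ} (hu0 : 0 ≤ u) (hu1 : u ≤ 1) :
    0 ≤ meanHit q n u := by
  induction n generalizing u with
  | zero => exact hu0
  | succ n ih =>
    have h2 := ih h0 h1
    have h3 := ih (mul_nonneg h0 hu0) (mul_le_one₀ h1 hu0 hu1)
    have h4 : 0 ≤ 1 - u := by linarith
    rw [meanHit]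
    positivity

lemma integral_hitFun_occupants (hκ : ∀ i, κ.real {a | j a = some i} = q)
    (v : List (Fin (d + 1))) (u : ℝ) :
    ∫ ξ, hitFun u (occupants (fieldJump j ξ) v).card ∂(fieldLaw d κ) = meanHit q v.length u := by
  induction v generalizing u with
  | nil => simp [occupants_nil, hitFun_one, meanHit]
  | cons i l ih =>
    simp only [occupants_cons]
    -- The occupants of `l` depend on jumps before time `|l|`, those of its child on the jumps at
    -- time `|l|` as well; the two groups are integrated separately.
    rw [integral_decouple κ (disjoint_pastIndices_currentIndices l.length)
      (G := fun ξ η => hitFun u (childOccupants (fieldJump j η) (occupants (fieldJump j ξ) l)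
        i l).card)]
    · have hint : ∀ u, Integrable (fun ξ => hitFun u (occupants (fieldJump j ξ) l).card)
          (fieldLaw d κ) := fun u => integrable_of_dependsOn κ fun ξ ξ' h => by
        have := dependsOn_occupants (j := j) l h
        simp only at this
        simp only [this]
      simp only [integral_hitFun_childOccupants hκ (fun x hx => length_le_of_mem_occupants hx)]
      rw [integral_add ((hint _).const_mul _) ((hint _).const_mul _), integral_const_mul,
        integral_const_mul, ih, ih, List.length_cons, meanHit]
    · intro η ξ ξ' h
      have := dependsOn_occupants (j := j) l h
      simp only at this
      simp only [this]
    · intro ξ η η' h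
      have := dependsOn_childOccupants (j := j) (occupants (fieldJump j ξ) l) i l
        (fun a ha => h a (Finset.coe_subset.2
          (jumpIndices_subset fun x hx => length_le_of_mem_occupants hx) ha))
      simp only at this
      simp only [this]

/-- The event that some vertex of level `n` is visited. -/
def levelVisited (j : α → Option (Fin (d + 1))) (n : ℕ) : Set (List (Fin (d + 1)) × ℕ → α) :=
  {ξ | ∃ v ∈ level d n, (occupants (fieldJump j ξ) v).Nonempty}

lemma measurableSet_occupants_nonempty (v : List (Fin (d + 1))) :
    MeasurableSet {ξ | (occupants (fieldJump j ξ) v).Nonempty} := by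
  refine measurableSet_setOfPred.2 (measurable_of_dependsOn (P := pastIndices d v.length) ?_)
  intro ξ ξ' h
  have := dependsOn_occupants (j := j) v h
  simp only at this
  simp only [this]

end process

/-! ### The subcritical and supercritical phases -/

section phases

variable {d : ℕ} {α : Type*} {j : α → Option (Fin (d + 1))} {q : ℝ}
  [Finite α] [Nonempty α] [MeasurableSpace α] [MeasurableSingletonClass α]

lemma measurableSet_levelVisited (n : ℕ) : MeasurableSet (levelVisited j n) := by
  have : levelVisited j n = ⋃ v ∈ level d n, {ξ | (occupants (fieldJump j ξ) v).Nonempty} := by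
    ext ξ; simp [levelVisited]
  rw [this]
  exact Finset.measurableSet_biUnion _ fun v _ => measurableSet_occupants_nonempty v

variable {κ : Measure α} [IsProbabilityMeasure κ]

lemma integrable_comp_occupants (f : Finset (List (Fin (d + 1))) → ℝ) (v : List (Fin (d + 1))) :
    Integrable (fun ξ => f (occupants (fieldJump j ξ) v)) (fieldLaw d κ) :=
  integrable_of_dependsOn κ fun _ _ h => congrArg f (dependsOn_occupants (j := j) v h)

/-- Markov's inequality: an occupied vertex has `hitFun q` at least `q`. -/
lemma mul_measureReal_occupants_nonempty_le (h0 : 0 ≤ q) (h1 : q ≤ 1)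
    (hκ : ∀ i, κ.real {a | j a = some i} = q) (v : List (Fin (d + 1))) :
    q * (fieldLaw d κ).real {ξ | (occupants (fieldJump j ξ) v).Nonempty}
      ≤ meanHit q v.length q := by
  have hm := measurableSet_occupants_nonempty (j := j) v
  rw [← integral_hitFun_occupants hκ, mul_comm, ← smul_eq_mul, ← integral_indicator_const q hm]
  refine integral_mono ((integrable_const q).indicator hm)
    (integrable_comp_occupants (fun A => hitFun q A.card) v) fun ξ => ?_
  by_cases h : (occupants (fieldJump j ξ) v).Nonempty
  · simpa [h] using le_hitFun h0 h1 h.card_pos.ne'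
  · simpa [h] using hitFun_nonneg h0 h1 _

/-- Extinction in the subcritical phase. -/
lemma tendsto_measureReal_levelVisited (hd : 1 ≤ d) (h0 : 0 < q) (hdq : (d : ℝ) * q < 1)
    (hF : locSum d q < 1) (hκ : ∀ i, κ.real {a | j a = some i} = q) :
    Filter.Tendsto (fun n => (fieldLaw d κ).real (levelVisited j n)) Filter.atTop (nhds 0) := by
  have h1 := le_one_of_natCast_mul_lt_one hd hdq
  -- The factor `d ^ n` accounts, up to the constant `2`, for the number of vertices at level `n`.
  have hlim := tendsto_zero_of_renewal (y := fun n i => d ^ n * meanHit q n (q ^ (i + 1))) hd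
    h0.le hdq hF
    (fun n i => mul_nonneg (by positivity)
      (meanHit_nonneg h0.le h1 n (by positivity) (pow_le_one₀ h0.le h1)))
    (fun i => by simp [meanHit])
    (fun n i => by
      simp only [meanHit]
      rw [show q * q ^ (i + 1) = q ^ (i + 1 + 1) by ring, show q ^ (0 + 1) = q by ring]
      ring)
  refine squeeze_zero (fun n => measureReal_nonneg) (fun n => ?_)
    (by simpa using hlim.const_mul (2 / q))
  have : levelVisited j n = ⋃ v ∈ level d n, {ξ | (occupants (fieldJump j ξ) v).Nonempty} := by
    ext ξ; simp [levelVisited]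
  rw [this]
  refine (measureReal_biUnion_finset_le _ _).trans ?_
  refine (Finset.sum_le_card_nsmul _ _ (meanHit q n q / q) fun v hv => ?_).trans ?_
  · rw [le_div_iff₀' h0, ← (mem_level.1 hv).1]
    exact mul_measureReal_occupants_nonempty_le h0.le h1 hκ v
  · have hc : ((level d n).card : ℝ) ≤ 2 * d ^ n := by exact_mod_cast card_level_le hd n
    have hm := meanHit_nonneg h0.le h1 n h0.le h1
    rw [nsmul_eq_mul]
    calc ((level d n).card : ℝ) * (meanHit q n q / q)
        ≤ (2 * d ^ n) * (meanHit q n q / q) := by gcongr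
      _ = _ := by ring

/-- A crude second-order expansion. It turns a product over dependent siblings into a sum, whose
expectation needs only the one-child means. -/
lemma prod_one_sub_le {ι : Type*} (s : Finset ι) {x : ι → ℝ} (h0 : ∀ i ∈ s, 0 ≤ x i)
    (h1 : ∀ i ∈ s, x i ≤ 1) :
    ∏ i ∈ s, (1 - x i) ≤ 1 - ∑ i ∈ s, x i + (∑ i ∈ s, x i) ^ 2 := by
  classical
  induction s using Finset.induction_on with
  | empty => simp
  | insert a s ha ih =>
    rw [Finset.prod_insert ha, Finset.sum_insert ha]
    have ih' := ih (fun i hi => h0 i (by simp [hi])) (fun i hi => h1 i (by simp [hi]))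
    have ha0 := h0 a (by simp)
    have ha1 := h1 a (by simp)
    have hS : 0 ≤ ∑ i ∈ s, x i := Finset.sum_nonneg fun i hi => h0 i (by simp [hi])
    have := mul_le_mul_of_nonneg_left ih' (by linarith : 0 ≤ 1 - x a)
    nlinarith [mul_nonneg ha0 hS, mul_nonneg ha0 (sq_nonneg (∑ i ∈ s, x i)), sq_nonneg (x a)]

lemma integral_eigenFun_childOccupants (hκ : ∀ i, κ.real {a | j a = some i} = q) (m : ℕ)
    {A : Finset (List (Fin (d + 1)))} {l : List (Fin (d + 1))} (hA : ∀ x ∈ A, x.length ≤ l.length)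
    (i : Fin (d + 1)) :
    ∫ ξ, eigenFun d q m (childOccupants (fieldJump j ξ) A i l).card ∂(fieldLaw d κ)
      = meanEigenFun d q m A.card := by
  simp only [eigenFun, meanEigenFun]
  rw [integral_finsetSum]
  · refine Finset.sum_congr rfl fun k _ => ?_
    rw [integral_const_mul, integral_hitFun_childOccupants hκ hA,
      show q * q ^ (k + 1) = q ^ (k + 2) by ring]
  · intro k _
    exact integrable_of_dependsOn κ fun _ _ h =>
      congrArg (fun B : Finset (List (Fin (d + 1))) =>
        eigenCoeff d q k * hitFun (q ^ (k + 1)) B.card)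
        (dependsOn_childOccupants (j := j) A i l h)

/-- The gain `1 + ε` in the mean outweighs the quadratic error: with `δ = θ (d + 1) C`, the
condition on `θ` says precisely that `(1 - δ) (1 + ε) ≥ 1`. -/
lemma integral_prod_children_le (hκ : ∀ i, κ.real {a | j a = some i} = q) (h0 : 0 ≤ q)
    (h1 : q ≤ 1) {m : ℕ} {ε C θ : ℝ} (hε : 0 < ε)
    (hexp : ∀ k, (1 + ε) * eigenFun d q m k ≤ d * meanEigenFun d q m k)
    (hC : ∀ k, eigenFun d q m k ≤ C) (hθ : 0 ≤ θ) (hθ1 : θ * C ≤ 1)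
    (hθ2 : (1 + ε) * (θ * ((d + 1) * C)) ≤ ε)
    {A : Finset (List (Fin (d + 1)))} {l : List (Fin (d + 1))}
    (hA : ∀ x ∈ A, x.length ≤ l.length) :
    ∫ ξ, ∏ i ∈ awayDirections l,
        (1 - θ * eigenFun d q m (childOccupants (fieldJump j ξ) A i l).card) ∂(fieldLaw d κ)
      ≤ 1 - θ * eigenFun d q m A.card := by
  have hn := eigenFun_nonneg d h0 h1 m
  have hC0 : 0 ≤ C := (hn 0).trans (hC 0)
  set S : (List (Fin (d + 1)) × ℕ → α) → ℝ := fun ξ =>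
    ∑ i ∈ awayDirections l, eigenFun d q m (childOccupants (fieldJump j ξ) A i l).card with hS
  have hint : ∀ i, Integrable
      (fun ξ => eigenFun d q m (childOccupants (fieldJump j ξ) A i l).card) (fieldLaw d κ) :=
    fun i => integrable_of_dependsOn κ fun _ _ h =>
      congrArg (fun B : Finset (List (Fin (d + 1))) => eigenFun d q m B.card)
        (dependsOn_childOccupants (j := j) A i l h)
  have hSint : Integrable S (fieldLaw d κ) := integrable_finsetSum _ fun i _ => hint i
  have hS0 : ∀ ξ, 0 ≤ S ξ := fun ξ => Finset.sum_nonneg fun i _ => hn _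
  have hS1 : ∀ ξ, S ξ ≤ (d + 1) * C := fun ξ => by
    refine (Finset.sum_le_card_nsmul _ _ C fun i _ => hC _).trans ?_
    rw [nsmul_eq_mul]
    gcongr
    exact_mod_cast (Finset.card_le_univ _).trans (by simp)
  have hmean : (1 + ε) * eigenFun d q m A.card ≤ ∫ ξ, S ξ ∂(fieldLaw d κ) := by
    rw [hS, integral_finsetSum _ fun i _ => hint i]
    simp only [integral_eigenFun_childOccupants hκ m hA, Finset.sum_const, nsmul_eq_mul]
    refine (hexp _).trans (mul_le_mul_of_nonneg_right
      (by exact_mod_cast le_card_awayDirections l) ?_)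
    -- The mean is nonnegative because it is the integral of a nonnegative function; the direction
    -- `0` is arbitrary.
    rw [← integral_eigenFun_childOccupants hκ m hA 0]
    exact integral_nonneg fun ξ => hn _
  set δ := θ * ((d + 1) * C) with hδ
  have hδ1 : δ < 1 := by
    have : 0 ≤ δ := by positivity
    nlinarith
  calc ∫ ξ, ∏ i ∈ awayDirections l,
        (1 - θ * eigenFun d q m (childOccupants (fieldJump j ξ) A i l).card) ∂(fieldLaw d κ)
      ≤ ∫ ξ, (1 - θ * (1 - δ) * S ξ) ∂(fieldLaw d κ) := by
        refine integral_mono (integrable_of_dependsOn κ (P := jumpIndices A l.length) ?_)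
          ((integrable_const _).sub (hSint.const_mul _)) fun ξ => ?_
        · intro ξ ξ' h
          refine Finset.prod_congr rfl fun i _ => ?_
          exact congrArg (fun B : Finset (List (Fin (d + 1))) => 1 - θ * eigenFun d q m B.card)
            (dependsOn_childOccupants (j := j) A i l h)
        · refine (prod_one_sub_le _ (fun i _ => mul_nonneg hθ (hn _))
            fun i _ => (mul_le_mul_of_nonneg_left (hC _) hθ).trans hθ1).trans ?_
          rw [← Finset.mul_sum]
          change 1 - θ * S ξ + (θ * S ξ) ^ 2 ≤ 1 - θ * (1 - δ) * S ξ
          have : θ * S ξ * (θ * S ξ) ≤ θ * S ξ * δ :=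
            mul_le_mul_of_nonneg_left (mul_le_mul_of_nonneg_left (hS1 ξ) hθ)
              (mul_nonneg hθ (hS0 ξ))
          nlinarith
    _ = 1 - θ * (1 - δ) * ∫ ξ, S ξ ∂(fieldLaw d κ) := by
        rw [integral_sub (integrable_const _) (hSint.const_mul _), integral_const_mul]
        simp
    _ ≤ 1 - θ * (1 - δ) * ((1 + ε) * eigenFun d q m A.card) := by
        have : 0 ≤ θ * (1 - δ) := mul_nonneg hθ (by linarith)
        have := mul_le_mul_of_nonneg_left hmean this
        linarith
    _ ≤ 1 - θ * eigenFun d q m A.card := by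
        have h3 : 1 ≤ (1 - δ) * (1 + ε) := by nlinarith
        have h4 : 0 ≤ θ * eigenFun d q m A.card := mul_nonneg hθ (hn _)
        nlinarith [mul_le_mul_of_nonneg_left h3 h4]

/-- Survival in the supercritical phase. -/
lemma exists_le_measureReal_levelVisited (h0 : 0 < q) (h1 : q ≤ 1)
    (hs : Summable (locTerm d q)) (hF : 1 < locSum d q)
    (hκ : ∀ i, κ.real {a | j a = some i} = q) :
    ∃ δ > 0, ∀ n, δ ≤ (fieldLaw d κ).real (levelVisited j n) := by
  obtain ⟨m, hm, ε, hε, hexp⟩ := exists_expanding_eigenFun h0 h1 hs hF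
  have hn := eigenFun_nonneg d h0.le h1 m
  set C := ∑ i ∈ Finset.range m, eigenCoeff d q i
  have hC : ∀ k, eigenFun d q m k ≤ C := eigenFun_le d h0.le h1 m
  have hpos := eigenFun_one_pos d h0 h1 hm
  have hC0 : 0 < C := hpos.trans_le (hC 1)
  -- The largest `θ` for which the quadratic error is still absorbed.
  set θ := ε / ((1 + ε) * ((d + 1) * C)) with hθ
  have hθ0 : 0 < θ := by positivity
  have hθ2 : (1 + ε) * (θ * ((d + 1) * C)) = ε := by
    rw [hθ]; field_simp
  have hθ1 : θ * C ≤ 1 := by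
    have hd0 : (0 : ℝ) ≤ d := by positivity
    have h2 : 0 ≤ θ * C := by positivity
    have h3 : 0 ≤ θ * C * d := by positivity
    have h4 : θ * ((d + 1) * C) = θ * C * d + θ * C := by ring
    rw [h4] at hθ2
    nlinarith
  let Z (n : ℕ) (ξ : List (Fin (d + 1)) × ℕ → α) : ℝ :=
    ∏ v ∈ level d n, (1 - θ * eigenFun d q m (occupants (fieldJump j ξ) v).card)
  have hfac : ∀ k, 0 ≤ 1 - θ * eigenFun d q m k := fun k => by
    have := mul_le_mul_of_nonneg_left (hC k) hθ0.le
    linarith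
  have hZdep : ∀ n, DependsOn (Z n) (pastIndices d n : Set _) := by
    intro n ξ ξ' h
    refine Finset.prod_congr rfl fun v hv => ?_
    exact congrArg (fun B : Finset (List (Fin (d + 1))) => 1 - θ * eigenFun d q m B.card)
      (dependsOn_occupants (j := j) v (by rwa [(mem_level.1 hv).1]))
  have hZint : ∀ n, Integrable (Z n) (fieldLaw d κ) := fun n =>
    integrable_of_dependsOn κ (hZdep n)
  -- Given the past, distinct vertices of level `n` hold disjoint sets of particles and hence use
  -- disjoint coordinates, so the expectation factors over them.
  have hstep : ∀ n, ∫ ξ, Z (n + 1) ξ ∂(fieldLaw d κ) ≤ ∫ ξ, Z n ξ ∂(fieldLaw d κ) := by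
    intro n
    let G (ξ η : List (Fin (d + 1)) × ℕ → α) : ℝ := ∏ l ∈ level d n, ∏ i ∈ awayDirections l,
      (1 - θ * eigenFun d q m
        (childOccupants (fieldJump j η) (occupants (fieldJump j ξ) l) i l).card)
    have hG : ∀ ξ, Z (n + 1) ξ = G ξ ξ := fun ξ => prod_level_succ n _
    have hGP : ∀ η, DependsOn (fun ξ => G ξ η) (pastIndices d n : Set _) := by
      intro η ξ ξ' h
      refine Finset.prod_congr rfl fun v hv => Finset.prod_congr rfl fun i _ => ?_
      exact congrArg (fun B : Finset (List (Fin (d + 1))) => 1 - θ * eigenFun d q m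
        (childOccupants (fieldJump j η) B i v).card)
        (dependsOn_occupants (j := j) v (by rwa [(mem_level.1 hv).1]))
    have hfactor : ∀ (B : Finset (List (Fin (d + 1)))) (l : List (Fin (d + 1))),
        DependsOn (fun η => ∏ i ∈ awayDirections l,
          (1 - θ * eigenFun d q m (childOccupants (fieldJump j η) B i l).card))
          (jumpIndices B l.length : Set _) := by
      intro B l η η' h
      refine Finset.prod_congr rfl fun i _ => ?_
      exact congrArg (fun B : Finset (List (Fin (d + 1))) => 1 - θ * eigenFun d q m B.card)
        (dependsOn_childOccupants (j := j) B i l h)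
    have hGL : ∀ ξ, DependsOn (G ξ) (currentIndices d n : Set _) := by
      intro ξ η η' h
      refine Finset.prod_congr rfl fun l hl => hfactor (occupants (fieldJump j ξ) l) l
        fun a ha => h a (Finset.coe_subset.2 ?_ ha)
      rw [(mem_level.1 hl).1]
      exact jumpIndices_subset fun x hx =>
        (length_le_of_mem_occupants hx).trans_eq (mem_level.1 hl).1
    simp only [hG]
    rw [integral_decouple κ (disjoint_pastIndices_currentIndices n) hGP hGL]
    have hle : ∀ ξ, ∫ η, G ξ η ∂(fieldLaw d κ) ≤ Z n ξ := by
      intro ξ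
      have := integral_prod_of_dependsOn κ (s := level d n)
        (A := fun l => jumpIndices (occupants (fieldJump j ξ) l) l.length)
        (f := fun l η => ∏ i ∈ awayDirections l, (1 - θ * eigenFun d q m
          (childOccupants (fieldJump j η) (occupants (fieldJump j ξ) l) i l).card))
        (fun l hl l' hl' hll => by
          refine Finset.disjoint_left.2 fun a ha ha' => hll ?_
          obtain ⟨x, hx, rfl⟩ := Finset.mem_image.1 ha
          obtain ⟨x', hx', h⟩ := Finset.mem_image.1 ha'
          obtain rfl : x' = x := congrArg Prod.fst h
          exact eq_of_mem_occupants ((mem_level.1 hl).1.trans (mem_level.1 hl').1.symm) hx hx')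
        (fun l _ => hfactor _ l)
      rw [this]
      refine Finset.prod_le_prod (fun l _ => integral_nonneg fun η =>
        Finset.prod_nonneg fun i _ => hfac _) fun l _ => ?_
      exact integral_prod_children_le hκ h0.le h1 hε hexp hC hθ0.le hθ1 hθ2.le
        fun x hx => length_le_of_mem_occupants hx
    refine integral_mono (integrable_of_dependsOn κ (P := pastIndices d n) ?_) (hZint n) hle
    intro ξ ξ' h
    exact integral_congr_ae (Filter.Eventually.of_forall fun η => hGP η h)
  have hZ : ∀ n, ∫ ξ, Z n ξ ∂(fieldLaw d κ) ≤ 1 - θ * eigenFun d q m 1 := by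
    intro n
    induction n with
    | zero => simp [Z, level, occupants_nil]
    | succ n ih => exact (hstep n).trans ih
  refine ⟨θ * eigenFun d q m 1, by positivity, fun n => ?_⟩
  have hm := measurableSet_levelVisited (j := j) n
  -- If level `n` is empty, then `Z n = 1`; so the expectation of `Z n` bounds the probability of
  -- this event.
  have hind : (fieldLaw d κ).real (levelVisited j n)ᶜ ≤ ∫ ξ, Z n ξ ∂(fieldLaw d κ) := by
    rw [← mul_one (Measure.real _ _), ← smul_eq_mul, ← integral_indicator_const 1 hm.compl]
    refine integral_mono ((integrable_const _).indicator hm.compl) (hZint n) fun ξ => ?_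
    by_cases h : ξ ∈ levelVisited j n
    · simpa [h] using Finset.prod_nonneg fun v _ => hfac _
    · have : Z n ξ = 1 := Finset.prod_eq_one fun v hv => by
        have hv' : occupants (fieldJump j ξ) v = ∅ :=
          Finset.not_nonempty_iff_eq_empty.1 fun hne => h ⟨v, hv, hne⟩
        simp [hv', eigenFun_zero]
      simp [h, this]
  rw [probReal_compl_eq_one_sub hm] at hind
  linarith [hZ n]

end phases

/-! ### Lifetimes and directions from independent jump variables -/

section law

/-- It suffices to compare finite-dimensional marginals, and these live on countable spaces, so
singletons decide. -/
lemma map_zip_infinitePi {I X Y : Type*} [Countable X] [Countable Y] [MeasurableSpace X]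
    [MeasurableSpace Y] [MeasurableSingletonClass X] [MeasurableSingletonClass Y]
    (μ : Measure X) (ν : Measure Y) [IsProbabilityMeasure μ] [IsProbabilityMeasure ν] :
    ((Measure.infinitePi fun _ : I => μ).prod (Measure.infinitePi fun _ : I => ν)).map
      (fun z k => (z.1 k, z.2 k)) = Measure.infinitePi fun _ : I => μ.prod ν := by
  have hz : Measurable fun (z : (I → X) × (I → Y)) k => (z.1 k, z.2 k) := by fun_prop
  refine ((Measure.isProjectiveLimit_infinitePi _).unique fun s => ?_).symm
  rw [Measure.map_map (Finset.measurable_restrict s) hz]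
  refine Measure.ext_of_singleton fun a => ?_
  rw [Measure.map_apply ((Finset.measurable_restrict s).comp hz) (measurableSet_singleton a),
    Measure.pi_singleton]
  classical
  have : (s.restrict ∘ fun (z : (I → X) × (I → Y)) k => (z.1 k, z.2 k)) ⁻¹' {a} =
      (Set.pi (s : Set I) fun k => if h : k ∈ s then {(a ⟨k, h⟩).1} else Set.univ) ×ˢ
      (Set.pi (s : Set I) fun k => if h : k ∈ s then {(a ⟨k, h⟩).2} else Set.univ) := by
    ext z
    simp only [Set.mem_preimage, Function.comp_apply, Set.mem_singleton_iff, funext_iff,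
      Finset.restrict, Subtype.forall, Prod.ext_iff, Set.mem_prod, Set.mem_pi, Finset.mem_coe]
    rw [← forall₂_and]
    refine forall₂_congr fun k hk => ?_
    simp [hk]
  rw [this, Measure.prod_prod, Measure.infinitePi_pi _ (fun k hk => by
      rw [dif_pos (Finset.mem_coe.1 hk)]; exact measurableSet_singleton _),
    Measure.infinitePi_pi _ (fun k hk => by
      rw [dif_pos (Finset.mem_coe.1 hk)]; exact measurableSet_singleton _),
    ← Finset.prod_mul_distrib, ← Finset.prod_attach, Finset.univ_eq_attach]
  refine Finset.prod_congr rfl fun k _ => ?_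
  rw [dif_pos k.2, dif_pos k.2, ← Measure.prod_prod, Set.singleton_prod_singleton]

/-- The law of a coin showing `true` with probability `p`. -/
noncomputable def coin (p : unitInterval) : Measure Bool :=
  ENNReal.ofReal p • Measure.dirac true + ENNReal.ofReal (1 - p) • Measure.dirac false

variable {p : unitInterval}

instance : IsProbabilityMeasure (coin p) := ⟨by
  simp [coin, ← ENNReal.ofReal_add p.2.1 (sub_nonneg.2 p.2.2)]⟩

lemma coin_true : coin p {true} = ENNReal.ofReal p := by simp [coin]

lemma coin_false : coin p {false} = ENNReal.ofReal (1 - p) := by simp [coin]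

lemma coin_ae_exists_false (hp : (p : ℝ) < 1) :
    ∀ᵐ b ∂(Measure.infinitePi fun _ : ℕ => coin p), ∃ k, b k = false := by
  rw [ae_iff]
  have hlim : Filter.Tendsto (fun n : ℕ => ENNReal.ofReal (p : ℝ) ^ n) Filter.atTop (nhds 0) :=
    ENNReal.tendsto_pow_atTop_nhds_zero_of_lt_one (by simpa using hp)
  refine le_antisymm (ge_of_tendsto' hlim fun n => ?_) zero_le
  calc (Measure.infinitePi fun _ : ℕ => coin p) {b | ¬∃ k, b k = false}
      ≤ (Measure.infinitePi fun _ : ℕ => coin p)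
          (Set.pi (Finset.range n : Set ℕ) fun _ => {true}) :=
        measure_mono fun b hb k _ => by simpa using fun h => hb ⟨k, h⟩
    _ = ENNReal.ofReal (p : ℝ) ^ n := by
        rw [Measure.infinitePi_pi _ (by simp)]
        simp [coin_true]

/-- The index of the first `false`. -/
noncomputable def firstFalse (b : ℕ → Bool) : ℕ := sInf {k | b k = false}

lemma lt_firstFalse_iff {b : ℕ → Bool} (hb : ∃ k, b k = false) {n : ℕ} :
    n < firstFalse b ↔ ∀ k ≤ n, b k = true := by
  constructor
  · intro h k hk
    have := Nat.notMem_of_lt_sInf (hk.trans_lt h)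
    simpa using this
  · intro h
    by_contra hlt
    have h1 : b (firstFalse b) = false := Nat.sInf_mem (s := {k | b k = false}) hb
    rw [h _ (not_lt.1 hlt)] at h1
    exact absurd h1 (by simp)

lemma firstFalse_eq_iff {b : ℕ → Bool} (hb : ∃ k, b k = false) {n : ℕ} :
    firstFalse b = n ↔ (∀ k < n, b k = true) ∧ b n = false := by
  constructor
  · rintro rfl
    refine ⟨fun k hk => ?_, Nat.sInf_mem (s := {k | b k = false}) hb⟩
    exact (lt_firstFalse_iff hb).1 hk k le_rfl
  · rintro ⟨h1, h2⟩
    refine le_antisymm (Nat.sInf_le h2) (not_lt.1 fun h => ?_)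
    have h3 : b (firstFalse b) = false := Nat.sInf_mem (s := {k | b k = false}) hb
    rw [h1 _ h] at h3
    exact absurd h3 (by simp)

lemma firstFalse_eq_of_forall {b : ℕ → Bool} (hb : ¬∃ k, b k = false) : firstFalse b = 0 := by
  have : {k | b k = false} = ∅ := by
    ext k; simpa using fun h => hb ⟨k, h⟩
  simp [firstFalse, this]

lemma measurable_firstFalse : Measurable firstFalse := by
  refine measurable_to_countable' fun n => ?_
  have hc : ∀ (k : ℕ) (c : Bool), MeasurableSet {b : ℕ → Bool | b k = c} := fun k c =>
    measurableSet_eq_fun (measurable_pi_apply k) measurable_const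
  have hE : MeasurableSet {b : ℕ → Bool | ∃ k, b k = false} := by
    have : {b : ℕ → Bool | ∃ k, b k = false} = ⋃ k, {b | b k = false} := by ext; simp
    rw [this]
    exact MeasurableSet.iUnion fun k => hc k _
  have hn : MeasurableSet {b : ℕ → Bool | (∀ k < n, b k = true) ∧ b n = false} := by
    have : {b : ℕ → Bool | (∀ k < n, b k = true) ∧ b n = false} =
        (⋂ k, ⋂ (_ : k < n), {b | b k = true}) ∩ {b | b n = false} := by ext; simp
    rw [this]
    exact (MeasurableSet.iInter fun k => MeasurableSet.iInter fun _ => hc k _).inter (hc n _)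
  -- A sequence without `false` is sent to `0`, the value of `sInf ∅`.
  have : firstFalse ⁻¹' {n} = {b | ∃ k, b k = false} ∩ {b | (∀ k < n, b k = true) ∧ b n = false} ∪
      {b | ∃ k, b k = false}ᶜ ∩ {_b | n = 0} := by
    ext b
    rw [Set.mem_union, Set.mem_inter_iff, Set.mem_inter_iff, Set.mem_compl_iff]
    change firstFalse b = n ↔ ((∃ k, b k = false) ∧ _) ∨ (¬(∃ k, b k = false) ∧ n = 0)
    by_cases hb : ∃ k, b k = false
    · rw [firstFalse_eq_iff hb]
      exact ⟨fun h => Or.inl ⟨hb, h⟩, fun h => h.elim And.right fun h => absurd hb h.1⟩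
    · rw [firstFalse_eq_of_forall hb]
      exact ⟨fun h => Or.inr ⟨hb, h.symm⟩, fun h => h.elim (fun h => absurd h.1 hb)
        fun h => h.2.symm⟩
  rw [this]
  exact (hE.inter hn).union (hE.compl.inter (MeasurableSet.const _))

lemma map_firstFalse (hp : (p : ℝ) < 1) :
    (Measure.infinitePi fun _ : ℕ => coin p).map firstFalse =
      geometricMeasure (unitInterval.symm p) := by
  have hs : unitInterval.symm p ≠ 0 := by
    intro h
    have := congrArg Subtype.val h
    simp at this
    linarith
  refine Measure.ext_of_singleton fun n => ?_
  rw [geometricMeasure_singleton hs, Measure.map_apply measurable_firstFalse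
    (measurableSet_singleton n)]
  -- For `p < 1` the sequence of all `true` is null; off it the event is the cylinder of `n` times
  -- `true` followed by `false`.
  have hae : firstFalse ⁻¹' {n} =ᵐ[Measure.infinitePi fun _ : ℕ => coin p]
      Set.pi (Finset.range (n + 1) : Set ℕ) fun k => if k = n then {false} else {true} := by
    filter_upwards [coin_ae_exists_false hp] with b hb
    refine propext ?_
    change firstFalse b = n ↔ b ∈ Set.pi _ _
    rw [firstFalse_eq_iff hb, Set.mem_pi]
    constructor
    · rintro ⟨h1, h2⟩ k hk
      have hk' : k < n + 1 := by simpa using hk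
      split_ifs with h
      · rw [h]; exact h2
      · exact h1 k (by omega)
    · intro h
      refine ⟨fun k hk => ?_, by simpa using h n (by simp)⟩
      simpa [hk.ne] using h k (by simp; omega)
  rw [measure_congr hae, Measure.infinitePi_pi _ (fun _ _ => Set.Finite.measurableSet
    (Set.toFinite _)), Finset.prod_range_succ]
  rw [Finset.prod_congr rfl (g := fun _ => ENNReal.ofReal (p : ℝ))]
  · simp [coin_false, ENNReal.ofReal_mul, ENNReal.ofReal_pow p.2.1, p.2.1]
  · intro k hk
    rw [if_neg (Finset.mem_range.1 hk).ne, coin_true]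

variable {d : ℕ}

/-- The law of one jump: a coin deciding on survival and a uniform direction. -/
noncomputable def jumpLaw (d : ℕ) (p : unitInterval) : Measure (Bool × Fin (d + 1)) :=
  (coin p).prod (uniformOn Set.univ)

instance : IsProbabilityMeasure (jumpLaw d p) := by unfold jumpLaw; infer_instance

/-- The direction of a jump, if the particle survives. -/
def jumpDirection (a : Bool × Fin (d + 1)) : Option (Fin (d + 1)) :=
  if a.1 then some a.2 else none

lemma jumpLaw_real (i : Fin (d + 1)) :
    (jumpLaw d p).real {a | jumpDirection a = some i} = p / (d + 1) := by
  have : {a : Bool × Fin (d + 1) | jumpDirection a = some i} = {true} ×ˢ {i} := by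
    ext ⟨b, k⟩; cases b <;> simp [jumpDirection]
  rw [this, jumpLaw, measureReal_prod_prod, measureReal_def, coin_true, measureReal_def,
    uniformOn_univ]
  have : ((d : ENNReal) + 1).toReal = d + 1 := by
    rw [ENNReal.toReal_add (by simp) (by simp)]; simp
  simp [p.2.1, div_eq_mul_inv, this]

/-- The lifetimes and directions encoded by a field of jumps. -/
noncomputable def outcomeOf (ξ : List (Fin (d + 1)) × ℕ → Bool × Fin (d + 1)) : Outcome d :=
  fun x => (firstFalse fun k => (ξ (x.1, k)).1, fun k => (ξ (x.1, k)).2)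

lemma measurable_outcomeOf : Measurable (outcomeOf (d := d)) := by
  refine measurable_pi_lambda _ fun x => Measurable.prodMk ?_ ?_
  · exact measurable_firstFalse.comp (by fun_prop)
  · fun_prop

/-- The field is regrouped by particles, the words that are not vertices are discarded, and each
remaining sequence of jumps is turned into a lifetime and directions. -/
lemma map_outcomeOf (hp : (p : ℝ) < 1) :
    (fieldLaw d (jumpLaw d p)).map outcomeOf = law d p := by
  let u : (ℕ → Bool × Fin (d + 1)) → ℕ × (ℕ → Fin (d + 1)) :=
    fun b => (firstFalse fun k => (b k).1, fun k => (b k).2)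
  have hu : Measurable u := Measurable.prodMk (measurable_firstFalse.comp (by fun_prop))
    (by fun_prop)
  have hu' : (Measure.infinitePi fun _ : ℕ => jumpLaw d p).map u =
      (geometricMeasure (unitInterval.symm p)).prod
        (Measure.infinitePi fun _ : ℕ => uniformOn (Set.univ : Set (Fin (d + 1)))) := by
    unfold jumpLaw
    rw [← map_zip_infinitePi, Measure.map_map hu (by fun_prop), ← map_firstFalse hp]
    conv_rhs => rw [← Measure.map_id (μ := Measure.infinitePi fun _ : ℕ =>
      uniformOn (Set.univ : Set (Fin (d + 1))))]
    rw [Measure.map_prod_map _ _ measurable_firstFalse measurable_id]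
    rfl
  have h1 := Measure.infinitePi_map_curry
    (fun (_ : List (Fin (d + 1))) (_ : ℕ) => jumpLaw d p)
  have h2 := Measure.map_infinitePi_infinitePi_of_inj
    (P := fun _ : List (Fin (d + 1)) => Measure.infinitePi fun _ : ℕ => jumpLaw d p)
    (f := fun x : Vertex d => x.1) Subtype.val_injective
  have h3 := Measure.infinitePi_map_pi
    (μ := fun _ : Vertex d => Measure.infinitePi fun _ : ℕ => jumpLaw d p) (f := fun _ => u)
    fun _ => hu
  rw [law]
  simp only [hu'] at h3
  rw [← h3, ← h2, ← h1, Measure.map_map (by fun_prop) (by fun_prop),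
    Measure.map_map (by fun_prop) (by fun_prop)]
  rfl

lemma ae_exists_false (hp : (p : ℝ) < 1) :
    ∀ᵐ ξ ∂(fieldLaw d (jumpLaw d p)), ∀ x : List (Fin (d + 1)), ∃ k, (ξ (x, k)).1 = false := by
  rw [ae_all_iff]
  intro x
  have h1 : (fieldLaw d (jumpLaw d p)).map (fun ξ k => (ξ (x, k)).1)
      = Measure.infinitePi fun _ : ℕ => coin p := by
    have h2 := Measure.map_infinitePi_infinitePi_of_inj
      (P := fun _ : List (Fin (d + 1)) × ℕ => jumpLaw d p)
      (f := fun k : ℕ => (x, k)) (Prod.mk_right_injective x)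
    have h3 := Measure.infinitePi_map_pi (μ := fun _ : ℕ => jumpLaw d p)
      (f := fun _ => Prod.fst) fun _ => measurable_fst
    have h4 : (jumpLaw d p).map Prod.fst = coin p := by
      rw [jumpLaw, Measure.map_fst_prod]; simp
    simp only [h4] at h3
    rw [← h3, ← h2, Measure.map_map (by fun_prop) (by fun_prop)]
    rfl
  have h2 := coin_ae_exists_false hp
  rw [← h1] at h2
  exact ae_of_ae_map (f := fun (ξ : List (Fin (d + 1)) × ℕ → Bool × Fin (d + 1)) k => (ξ (x, k)).1)
    (Measurable.aemeasurable (by fun_prop)) h2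

/-- The field may show further jumps after the first `false`, whereas a lifetime ends for good; by
`occupants_congr` the jumps after death are irrelevant. -/
lemma occupants_outcomeOf {ξ : List (Fin (d + 1)) × ℕ → Bool × Fin (d + 1)}
    (hξ : ∀ x : List (Fin (d + 1)), ∃ k, (ξ (x, k)).1 = false) {v : List (Fin (d + 1))}
    (hv : v.IsChain (fun a b => a ≠ b)) :
    occupants (jumpOf (outcomeOf ξ)) v = occupants (fieldJump jumpDirection ξ) v := by
  refine (occupants_congr fun x hx k _ hj => ?_).1
  have hxc : x.IsChain (fun a b => a ≠ b) := hv.suffix hx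
  have hb : ∀ m < k, (ξ (x, m)).1 = true := fun m hm => by
    by_contra h
    exact hj m hm (by simp [fieldJump, jumpDirection, h])
  have hlt : k < lifetime (outcomeOf ξ) ⟨x, hxc⟩ ↔ (ξ (x, k)).1 = true := by
    change k < firstFalse _ ↔ _
    rw [lt_firstFalse_iff (hξ x)]
    refine ⟨fun h => h k le_rfl, fun h m hm => ?_⟩
    rcases hm.lt_or_eq with hm | rfl
    · exact hb m hm
    · exact h
  simp only [jumpOf, hxc, dite_true, hlt, fieldJump, jumpDirection]
  rfl

lemma measurableSet_mem_occupants (v x : List (Fin (d + 1))) :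
    MeasurableSet {ω : Outcome d | x ∈ occupants (jumpOf ω) v} := by
  induction v generalizing x with
  | nil => simp only [occupants_nil]; exact MeasurableSet.const _
  | cons i l ih =>
    have hj : ∀ x : List (Fin (d + 1)), MeasurableSet
        {ω : Outcome d | x ∈ jumpers (jumpOf ω) (occupants (jumpOf ω) l) i l.length} := by
      intro x
      by_cases hx : x.IsChain (fun a b => a ≠ b)
      · have e : {ω : Outcome d | x ∈ jumpers (jumpOf ω) (occupants (jumpOf ω) l) i l.length} =
            {ω | x ∈ occupants (jumpOf ω) l} ∩
              ({ω | l.length - x.length < (ω ⟨x, hx⟩).1} ∩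
                {ω | (ω ⟨x, hx⟩).2 (l.length - x.length) = i}) := by
          ext ω
          have h := jumpOf_eq_some (ω := ω) (x := ⟨x, hx⟩) (k := l.length - x.length) (i := i)
          simp only at h
          change x ∈ jumpers _ _ _ _ ↔ _
          rw [mem_jumpers, h]
          rfl
        rw [e]
        exact (ih x).inter ((measurableSet_lt measurable_const (by fun_prop)).inter
          (measurableSet_eq_fun (by fun_prop) measurable_const))
      · have e : {ω : Outcome d | x ∈ jumpers (jumpOf ω) (occupants (jumpOf ω) l) i l.length} =
            ∅ := by
          ext ω
          simp [mem_jumpers, jumpOf, hx]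
        rw [e]
        exact MeasurableSet.empty
    have e : {ω : Outcome d | x ∈ occupants (jumpOf ω) (i :: l)} =
        {ω | x ∈ jumpers (jumpOf ω) (occupants (jumpOf ω) l) i l.length} ∪
          ({_ω | x = i :: l} ∩
            ⋃ y, {ω | y ∈ jumpers (jumpOf ω) (occupants (jumpOf ω) l) i l.length}) := by
      ext ω
      simp [occupants_cons, mem_childOccupants, Finset.Nonempty]
    rw [e]
    exact (hj x).union ((MeasurableSet.const _).inter (MeasurableSet.iUnion hj))

lemma measurableSet_survival : MeasurableSet (survival d) := by
  have : survival d = ⋂ t, ⋃ v ∈ level d t, ⋃ x, {ω | x ∈ occupants (jumpOf ω) v} := by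
    ext ω
    simp [mem_survival_iff, Finset.Nonempty]
  rw [this]
  exact MeasurableSet.iInter fun t => Finset.measurableSet_biUnion _ fun v _ =>
    MeasurableSet.iUnion fun x => measurableSet_mem_occupants v x

/-! ### The survival probability and the critical parameter -/

lemma survivalProb_eq (hp : (p : ℝ) < 1) :
    survivalProb d p =
      (fieldLaw d (jumpLaw d p)).real (⋂ n, levelVisited (d := d) jumpDirection n) := by
  rw [survivalProb, ← map_outcomeOf hp, map_measureReal_apply measurable_outcomeOf
    measurableSet_survival]
  refine measureReal_congr ?_
  filter_upwards [ae_exists_false hp] with ξ hξ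
  refine propext ?_
  change outcomeOf ξ ∈ survival d ↔ ξ ∈ ⋂ n, _
  rw [mem_survival_iff, Set.mem_iInter]
  refine forall_congr' fun t => exists_congr fun v => and_congr_right fun hv => ?_
  rw [occupants_outcomeOf hξ (mem_level.1 hv).2]

lemma levelVisited_antitone {α : Type*} (j : α → Option (Fin (d + 1))) :
    Antitone (levelVisited j) := by
  refine antitone_nat_of_succ_le fun n ξ hξ => ?_
  obtain ⟨v, hv, hne⟩ := hξ
  obtain ⟨h1, h2⟩ := mem_level.1 hv
  exact ⟨v.tail, mem_level.2 ⟨by simp [h1], h2.tail⟩, occupants_nonempty_tail hne⟩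

lemma mul_div_lt_one (hp : (p : ℝ) < 1) : (d : ℝ) * (p / (d + 1)) < 1 := by
  rw [mul_div_assoc', div_lt_one (by positivity)]
  have := p.2.1
  nlinarith [(Nat.cast_nonneg d : (0 : ℝ) ≤ d)]

lemma survivalProb_eq_zero (hd : 1 ≤ d) (hp0 : 0 < (p : ℝ)) (hp : (p : ℝ) < 1)
    (hF : locSum d (p / (d + 1)) < 1) : survivalProb d p = 0 := by
  rw [survivalProb_eq hp]
  have hlim := tendsto_measureReal_levelVisited (j := jumpDirection) (κ := jumpLaw d p) hd
    (by positivity) (mul_div_lt_one hp) hF jumpLaw_real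
  refine le_antisymm (ge_of_tendsto' hlim fun n => ?_) measureReal_nonneg
  exact measureReal_mono (Set.iInter_subset _ n)

lemma survivalProb_pos (hd : 1 ≤ d) (hp0 : 0 < (p : ℝ)) (hp : (p : ℝ) < 1)
    (hF : 1 < locSum d (p / (d + 1))) : 0 < survivalProb d p := by
  rw [survivalProb_eq hp]
  have hq0 : 0 < (p : ℝ) / (d + 1) := by positivity
  obtain ⟨δ, hδ, h⟩ := exists_le_measureReal_levelVisited (j := jumpDirection) (κ := jumpLaw d p)
    hq0 (le_one_of_natCast_mul_lt_one hd (mul_div_lt_one hp))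
    (summable_locTerm hd hq0.le (mul_div_lt_one hp)) hF jumpLaw_real
  -- The level events decrease, so continuity from above carries the uniform bound `δ` to survival.
  have hlim := tendsto_measure_iInter_atTop (μ := fieldLaw d (jumpLaw d p))
    (s := levelVisited (d := d) jumpDirection)
    (fun n => (measurableSet_levelVisited n).nullMeasurableSet) (levelVisited_antitone _)
    ⟨0, measure_ne_top _ _⟩
  have hlim' := (ENNReal.tendsto_toReal (measure_ne_top _ _)).comp hlim
  exact hδ.trans_le (ge_of_tendsto' hlim' h)

/-- The critical parameter is determined by the solution of the equation. -/
lemma criticalParameter_eq (hd : 2 ≤ d) {q : ℝ} (h0 : 0 < q) (h1 : ((d : ℝ) + 1) * q < 1)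
    (hq : locSum d q = 1) : criticalParameter d = ((d : ℝ) + 1) * q := by
  have hd0 : (0 : ℝ) < d + 1 := by positivity
  refine IsGLB.csInf_eq ⟨?_, fun b hb => ?_⟩ ?_
  · rintro x ⟨p, rfl, hp0, hp1, hpos⟩
    by_contra hlt
    have h2 : (p : ℝ) / (d + 1) < q := by
      rw [div_lt_iff₀ hd0]; linarith
    have h3 : locSum d (p / (d + 1)) < 1 :=
      (locSum_strictMono hd (by positivity) h2 (by linarith)).trans_eq hq
    exact hpos.ne' (survivalProb_eq_zero (by omega) hp0 hp1 h3)
  -- Maximality of the lower bound and nonemptiness of the set both use that every `x` strictly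
  -- between `(d + 1) q` and `1` allows survival.
  all_goals
    have hmem : ∀ x : ℝ, (d + 1) * q < x → x < 1 → x ∈ {x : ℝ | ∃ p : unitInterval,
        (p : ℝ) = x ∧ 0 < x ∧ x < 1 ∧ 0 < survivalProb d p} := by
      intro x hx1 hx2
      have hx0 : 0 < x := lt_trans (by positivity) hx1
      refine ⟨⟨x, hx0.le, hx2.le⟩, rfl, hx0, hx2, survivalProb_pos (by omega) hx0 hx2 ?_⟩
      refine hq.symm.trans_lt (locSum_strictMono hd h0.le ?_ (mul_div_lt_one (p := ⟨x, hx0.le, hx2.le⟩) hx2))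
      rw [lt_div_iff₀ hd0]
      simpa [mul_comm] using hx1
  · by_contra hlt
    obtain ⟨x, hx1, hx2⟩ := exists_between (lt_min (not_le.1 hlt) h1)
    exact absurd (hb (hmem x hx1 (hx2.trans_le (min_le_right _ _))))
      (not_le.2 (hx2.trans_le (min_le_left _ _)))
  · obtain ⟨x, hx1, hx2⟩ := exists_between h1
    exact ⟨x, hmem x hx1 hx2⟩

end law

/-- The range `p < (d + 1) / d` is exactly `d q < 1`, where strict monotonicity of `locSum` gives
uniqueness. -/
lemma criticalParameter_spec {d : ℕ} (hd : 2 ≤ d) {q : ℝ} (h0 : 0 < q)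
    (h1 : ((d : ℝ) + 1) * q < 1) (hq : locSum d q = 1) :
    criticalParameter d ∈ Set.Ioo (0 : ℝ) 1 ∧
      LocalizationEq d 1 (criticalParameter d / ((d : ℝ) + 1)) ∧
      ∀ p : ℝ, 0 < p → p < ((d : ℝ) + 1) / (d : ℝ) →
        LocalizationEq d 1 (p / ((d : ℝ) + 1)) → p = criticalParameter d := by
  have hd0 : (0 : ℝ) < d + 1 := by positivity
  have hd1 : (0 : ℝ) < d := by positivity
  have hdq : (d : ℝ) * q < 1 := by linarith
  rw [criticalParameter_eq hd h0 h1 hq, mul_div_cancel_left₀ _ hd0.ne']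
  refine ⟨⟨by positivity, h1⟩, (localizationEq_iff_locSum (by omega) h0.le hdq).2 hq, ?_⟩
  intro p hp0 hp1 hp
  have hr0 : 0 < p / (d + 1) := by positivity
  have hr1 : (d : ℝ) * (p / (d + 1)) < 1 := by
    rw [mul_div_assoc', div_lt_one hd0]
    rw [lt_div_iff₀ hd1] at hp1
    linarith
  rw [localizationEq_iff_locSum (by omega) hr0.le hr1] at hp
  have : p / (d + 1) = q := by
    rcases lt_trichotomy (p / ((d : ℝ) + 1)) q with h | h | h
    · exact absurd (locSum_strictMono hd hr0.le h hdq) (by rw [hp, hq]; exact lt_irrefl _)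
    · exact h
    · exact absurd (locSum_strictMono hd h0.le h hr1) (by rw [hp, hq]; exact lt_irrefl _)
  rw [← this]
  field_simp

end FrogRemoval

theorem mainTheorem7 :
    (∀ d : ℕ, 2 ≤ d →
      FrogRemoval.criticalParameter d ∈ Set.Ioo (0 : ℝ) 1 ∧
      FrogRemoval.LocalizationEq d 1 (FrogRemoval.criticalParameter d / ((d : ℝ) + 1)) ∧
      ∀ p : ℝ, 0 < p → p < ((d : ℝ) + 1) / (d : ℝ) →
        FrogRemoval.LocalizationEq d 1 (p / ((d : ℝ) + 1)) →
          p = FrogRemoval.criticalParameter d) ∧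
    ((0.8 : ℝ) ≤ FrogRemoval.criticalParameter 2 ∧
      FrogRemoval.criticalParameter 2 ≤ (0.831619 : ℝ)) ∧
    (∀ d : ℕ, 3 ≤ d →
      ((d : ℝ) + 1) / (2 * (d : ℝ) - 1 / 4) ≤ FrogRemoval.criticalParameter d ∧
      FrogRemoval.criticalParameter d ≤
        ((d : ℝ) + 1) * (7 * (d : ℝ) - 1) *
          (1 - Real.sqrt (1 - 14 / (7 * (d : ℝ) - 1) ^ 2)) / 2) := by
  have two : ∃ q ∈ Set.Icc (4 / 15 : ℝ) (0.831619 / 3),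
      FrogRemoval.locSum 2 q = 1 ∧ 0 < q ∧ (((2 : ℕ) : ℝ) + 1) * q < 1 := by
    obtain ⟨q, hq, h⟩ := FrogRemoval.exists_root_two
    refine ⟨q, hq, h, by linarith [hq.1], ?_⟩
    have := hq.2
    push_cast
    linarith
  have three : ∀ d : ℕ, 3 ≤ d →
      ∃ q ∈ Set.Icc (1 / (2 * (d : ℝ) - 1 / 4)) (FrogRemoval.upperRoot d),
        FrogRemoval.locSum d q = 1 ∧ 0 < q ∧ ((d : ℝ) + 1) * q < 1 := by
    intro d hd
    obtain ⟨q, hq, h⟩ := FrogRemoval.exists_root_of_three_le hd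
    obtain ⟨hu0, hu1, hu⟩ := FrogRemoval.upperRoot_spec hd
    have hd' : (3 : ℝ) ≤ d := by exact_mod_cast hd
    have hpos : (0 : ℝ) < 1 / (2 * d - 1 / 4) := one_div_pos.2 (by linarith)
    refine ⟨q, hq, h, hpos.trans_le hq.1, ?_⟩
    -- With `u` the upper root, `(d + 1) u = 1/2 + 8 u / 7 + u² / 7`, which is below `1` because `u
    -- ≤ 3/16`.
    have := mul_le_mul_of_nonneg_left hq.2 (by linarith : (0 : ℝ) ≤ d + 1)
    nlinarith
  refine ⟨fun d hd => ?_, ?_, fun d hd => ?_⟩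
  · rcases hd.eq_or_lt with rfl | hd3
    · obtain ⟨q, -, h, h0, h1⟩ := two
      exact FrogRemoval.criticalParameter_spec hd h0 h1 h
    · obtain ⟨q, -, h, h0, h1⟩ := three d hd3
      exact FrogRemoval.criticalParameter_spec hd h0 h1 h
  · obtain ⟨q, hq, h, h0, h1⟩ := two
    rw [FrogRemoval.criticalParameter_eq le_rfl h0 h1 h]
    have h2 := hq.1
    have h3 := hq.2
    constructor <;> push_cast <;> linarith
  · obtain ⟨q, hq, h, h0, h1⟩ := three d hd
    rw [FrogRemoval.criticalParameter_eq (by omega) h0 h1 h]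
    have hd0 : (0 : ℝ) ≤ d + 1 := by positivity
    have h2 := mul_le_mul_of_nonneg_left hq.1 hd0
    have h3 := mul_le_mul_of_nonneg_left hq.2 hd0
    constructor
    · rwa [mul_one_div] at h2
    · refine h3.trans_eq ?_
      rw [FrogRemoval.upperRoot]
      ring
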